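/- **Theorem.** Write $\mathbf t=(t_0,t_1,t_2,\dots)$, $x=t_0$, $\mathbb C[[\mathbf t]]=\mathbb C[[t_0,t_1,\dots]]$ and $\mathbf t\mp[z^{-1}]=\bigl(t_k\mp (2k-1)!!\,z^{-2k-1}\bigr)_{k\ge0}$ (with $(-1)!!=1$), and let $\vartheta(z;\mathbf t)=\sum_{j\ge0}t_j\frac{z^{2j+1}}{(2j+1)!!}$. A *tau-function of the KdV hierarchy* is a nonzero $\tau\in\mathbb C[[\mathbf t]]$ satisfying the Hirota bilinear identities $$\operatorname*{res}_{z=\infty}\ \tau(\mathbf t-[z^{-1}])\,\tau(\tilde{\mathbf t}+[z^{-1}])\,\exp\Bigl(\sum_{j\ge0}\frac{t_j-\tilde t_j}{(2j+1)!!}z^{2j+1}\Bigr)z^{2p}\,dz=0\qquad(p=0,1,2,\dots)$$ identically in $\mathbf t,\tilde{\mathbf t}$, where the residue is minus the coefficient of $z^{-1}$. Its wave and dual wave functions are $$\psi=\frac{\tau(\mathbf t-[z^{-1}])}{\tau(\mathbf t)}e^{\vartheta(z;\mathbf t)},\qquad \psi^*=\frac{\tau(\mathbf t+[z^{-1}])}{\tau(\mathbf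 t)}e^{-\vartheta(z;\mathbf t)},$$ and its generating function of one-point correlation functions is $$F_1(z;\mathbf t)=\sum_{k\ge0}\frac{\partial\log\tau}{\partial t_k}(\mathbf t)\,\frac{(2k+1)!!}{z^{2k+2}},\qquad \frac{\partial\log\tau}{\partial t_k}=\frac1\tau\frac{\partial\tau}{\partial t_k}.$$ All these series are regarded as elements of the field of fractions of $\mathbb C((z^{-1}))[[\mathbf t]]$, with the derivations $\partial_x$ and $\partial_z$. Let $\tau$ be any tau-function of the KdV hierarchy and put $$\Psi=\begin{pmatrix}\psi&\psi^*\\-\psi_x&-\psi^*_x\end{pmatrix},\qquad \sigma_3=\begin{pmatrix}1&0\\0&-1\end{pmatrix}.$$ Then: 1. $\Psi$ is invertible and $$F_1(z;\mathbf t)=\tfrac12\operatorname{Tr}\bigl(\Psi^{-1}\Psi_z\sigma_3\bigr)-\vartheta_z(z;\mathbf t).$$ 2. This identity determines $\tau$ from $\psi,\psi^*$ up to a multiplicative constant: for a nonzero $\rho\in\mathbb C[[\mathbf t]]$, the series $\sum_{k\ge0}\frac{\partial\log\rho}{\partial t_k}\frac{(2k+1)!!}{z^{2k+2}}$ equals $\frac12\operatorname{Tr}(\Psi^{-1}\Psi_z\sigma_3)-\vartheta_z$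 if and only if $\rho=c\,\tau$ for some $c\in\mathbb C\setminus\{0\}$. Moreover a tau-function $\rho$ has the same wave function $\psi$ as $\tau$ if and only if $\rho=c\,\tau$ for some $c\in\mathbb C\setminus\{0\}$. -/

import Mathlib

noncomputable section

namespace KdV

open MvPowerSeries

/-! ### Rings of formal series

The times `t₀, t₁, t₂, …` are indexed by `ℕ`, and `x = t₀`.  The spectral parameter `z` is kept
near `z = ∞`: the variable of the power series ring `FockZ` and of the Laurent series ring
`LaurentZ` is `z⁻¹`. -/

/-- The bosonic Fock space `ℂ[[t₀, t₁, t₂, …]]`. -/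
abbrev Fock : Type := MvPowerSeries ℕ ℂ

/-- `ℂ[[t₀, t₁, …]][[z⁻¹]]`; the power series variable is `z⁻¹`. -/
abbrev FockZ : Type := PowerSeries Fock

/-- `ℂ((z⁻¹))`: the coefficient at `n : ℤ` is the coefficient of `z⁻ⁿ`. -/
abbrev LaurentZ : Type := LaurentSeries ℂ

/-- `ℂ((z⁻¹))[[t₀, t₁, …]]`.  It contains both `ℂ[[t]][[z⁻¹]]` and `exp ϑ(z;t)`. -/
abbrev WaveRing : Type := MvPowerSeries ℕ LaurentZ

/-- The field of fractions of `ℂ((z⁻¹))[[t₀, t₁, …]]`, in which the wave functions live. -/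
abbrev WaveField : Type := FractionRing WaveRing

/-- The element `z` of `ℂ((z⁻¹))`. -/
def zL : LaurentZ := HahnSeries.single (-1) 1

/-- The formal residue at `z = ∞`: minus the coefficient of `z⁻¹`. -/
def resInfty (f : LaurentZ) : ℂ := -f.coeff 1

instance : IsDomain Fock := NoZeroDivisors.to_isDomain _

instance : IsDomain WaveRing := NoZeroDivisors.to_isDomain _

/-- The inclusion `ℂ[[t]][[z⁻¹]] → ℂ((z⁻¹))[[t]]`, as a map. -/
def embedFun (f : FockZ) : WaveRing := fun m => HahnSeries.ofPowerSeries ℤ ℂ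
  (PowerSeries.mk fun n => MvPowerSeries.coeff m (PowerSeries.coeff n f))

theorem coeff_embedFun (f : FockZ) (m : ℕ →₀ ℕ) :
    MvPowerSeries.coeff m (embedFun f) = HahnSeries.ofPowerSeries ℤ ℂ
      (PowerSeries.mk fun n => MvPowerSeries.coeff m (PowerSeries.coeff n f)) := rfl

/-- The inclusion `ℂ[[t]][[z⁻¹]] → ℂ((z⁻¹))[[t]]`, as a ring homomorphism. -/
def embed : FockZ →+* WaveRing where
  toFun := embedFun
  map_one' := by
    ext1 m
    rw [coeff_embedFun, MvPowerSeries.coeff_one]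
    have : (PowerSeries.mk fun n => MvPowerSeries.coeff m (PowerSeries.coeff n (1 : FockZ)))
        = if m = 0 then 1 else 0 := by
      ext n
      rw [PowerSeries.coeff_mk, PowerSeries.coeff_one]
      by_cases hn : n = 0 <;> by_cases hm : m = 0 <;>
        simp [hn, hm, MvPowerSeries.coeff_one, PowerSeries.coeff_one]
    rw [this]
    split_ifs <;> simp
  map_mul' f g := by
    ext1 m
    simp_rw [MvPowerSeries.coeff_mul, coeff_embedFun, ← map_mul]
    rw [← map_sum]
    congr 1
    ext n
    rw [PowerSeries.coeff_mk, PowerSeries.coeff_mul, map_sum, map_sum]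
    simp_rw [MvPowerSeries.coeff_mul, PowerSeries.coeff_mul, PowerSeries.coeff_mk]
    rw [Finset.sum_comm]
  map_zero' := by
    ext1 m
    have : (PowerSeries.mk fun n => MvPowerSeries.coeff m (PowerSeries.coeff n (0 : FockZ)))
        = 0 := by
      ext n
      simp
    rw [coeff_embedFun, this, map_zero, map_zero]
  map_add' f g := by
    ext1 m
    rw [map_add, coeff_embedFun, coeff_embedFun, coeff_embedFun, ← map_add]
    congr 1

theorem coeff_embed (f : FockZ) (m : ℕ →₀ ℕ) :
    MvPowerSeries.coeff m (embed f) = HahnSeries.ofPowerSeries ℤ ℂ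
      (PowerSeries.mk fun n => MvPowerSeries.coeff m (PowerSeries.coeff n f)) := rfl

theorem embed_injective : Function.Injective embed := by
  intro f g h
  ext n m
  have h1 := congrArg (MvPowerSeries.coeff m) h
  rw [coeff_embed, coeff_embed] at h1
  have h2 := congrArg (PowerSeries.coeff n) (HahnSeries.ofPowerSeries_injective h1)
  simpa using h2

/-- The formal linear series `∑ⱼ cⱼ tⱼ`. -/
def linearSeries {A : Type*} [CommRing A] (c : ℕ → A) : MvPowerSeries ℕ A :=
  fun m => if m.degree = 1 then ∑ j ∈ m.support, c j else 0

theorem coeff_single_linearSeries {A : Type*} [CommRing A] (c : ℕ → A) (j : ℕ) :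
    MvPowerSeries.coeff (Finsupp.single j 1) (linearSeries c) = c j := by
  change (if (Finsupp.single j 1).degree = 1 then _ else _) = _
  rw [if_pos (by simp), Finsupp.support_single _ one_ne_zero, Finset.sum_singleton]

/-- The phase `ϑ(z;t) = ∑ⱼ tⱼ z^(2j+1) / (2j+1)!!`. -/
def theta : WaveRing :=
  linearSeries fun j =>
    HahnSeries.single (-(2 * (j : ℤ) + 1)) ((Nat.doubleFactorial (2 * j + 1) : ℂ)⁻¹)

/-- `exp f` for a formal series `f` without constant term. -/
def expSeries {σ : Type*} (f : MvPowerSeries σ LaurentZ) : MvPowerSeries σ LaurentZ :=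
  (PowerSeries.exp LaurentZ).subst f

/-- `τ(t + ε [z⁻¹])`, where `[z⁻¹] = (z⁻¹, …, (2k-1)!! z^(-2k-1), …)`, as an element of
`ℂ[[t]][[z⁻¹]]`: substitute `t_k ↦ t_k + ε (2k-1)!! z^(-2k-1)` in `τ`, with `z⁻¹` as the extra
variable `X none` (for `k = 0` the double factorial is `(-1)!! = 1 = 0!!`). -/
def shift (ε : ℂ) (τ : Fock) : FockZ :=
  MvPowerSeries.optionEquivLeft ℕ ℂ
    (τ.subst fun k : ℕ => (X (some k) : MvPowerSeries (Option ℕ) ℂ)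
      + (ε * (Nat.doubleFactorial (2 * k - 1) : ℂ)) • X none ^ (2 * k + 1))

theorem hasSubst_shift (ε : ℂ) :
    HasSubst fun k : ℕ => (X (some k) : MvPowerSeries (Option ℕ) ℂ)
      + (ε * (Nat.doubleFactorial (2 * k - 1) : ℂ)) • X none ^ (2 * k + 1) where
  const_coeff k := by simp
  coeff_zero d := by
    refine ((d.support.preimage some (Option.some_injective _).injOn).finite_toSet.union
      (Set.finite_le_nat (d none))).subset ?_
    intro k hk
    by_contra hc
    simp only [Set.mem_union, Finset.mem_coe, Finset.mem_preimage, Finsupp.mem_support_iff,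
      Set.mem_ofPred_eq, not_or, not_not, not_le] at hc
    apply hk
    have h1 : d ≠ Finsupp.single (some k) 1 := by
      rintro rfl
      simp at hc
    have h2 : d ≠ Finsupp.single none (2 * k + 1) := by
      rintro rfl
      simp at hc
      omega
    rw [map_add, MvPowerSeries.coeff_X, if_neg h1, map_smul, MvPowerSeries.coeff_X_pow, if_neg h2]
    simp

/-! ### Tau-functions -/

/-- The product `τ(t - [z⁻¹]) τ(t̃ + [z⁻¹]) exp (∑_{j ≥ 0} (tⱼ - t̃ⱼ) z^(2j+1) / (2j+1)!!)` in
`ℂ((z⁻¹))[[t, t̃]]`; the times `t` are the left summand of `ℕ ⊕ ℕ`, the times `t̃` the right one. -/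
def hirotaProduct (τ : Fock) : MvPowerSeries (ℕ ⊕ ℕ) LaurentZ :=
  rename (Function.Embedding.inl : ℕ ↪ ℕ ⊕ ℕ) (embed (shift (-1) τ))
    * rename (Function.Embedding.inr : ℕ ↪ ℕ ⊕ ℕ) (embed (shift 1 τ))
    * expSeries (rename (Function.Embedding.inl : ℕ ↪ ℕ ⊕ ℕ) theta
        - rename (Function.Embedding.inr : ℕ ↪ ℕ ⊕ ℕ) theta)

/-- A (Sato) tau-function of the KdV hierarchy: a nonzero element of the Fock space that satisfies
the Hirota bilinear identities `res_{z=∞} τ(t-[z⁻¹]) τ(t̃+[z⁻¹]) e^(ϑ(z;t)-ϑ(z;t̃)) z^(2p) dz = 0`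
for all `p ≥ 0`, identically in `t` and `t̃`. -/
structure IsTauFunction (τ : Fock) : Prop where
  ne_zero : τ ≠ 0
  hirota : ∀ (p : ℕ) (m : ℕ ⊕ ℕ →₀ ℕ),
    resInfty (MvPowerSeries.coeff m (hirotaProduct τ) * zL ^ (2 * p)) = 0

/-! ### Derivations -/

/-- `∂/∂z` on `ℂ((z⁻¹))`: it sends `z⁻ⁿ` to `-n z⁻ⁿ⁻¹`. -/
def dzLaurent (f : LaurentZ) : LaurentZ :=
  HahnSeries.single 1 1 *
    { coeff := fun n : ℤ => -(n : ℂ) * f.coeff n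
      isPWO_support' := f.isPWO_support.mono fun n hn h => hn (by simp [h]) }

theorem coeff_dzLaurent (f : LaurentZ) (n : ℤ) :
    (dzLaurent f).coeff (n + 1) = -(n : ℂ) * f.coeff n := by
  rw [dzLaurent, HahnSeries.coeff_single_mul_add, one_mul]

theorem dzLaurent_add (f g : LaurentZ) : dzLaurent (f + g) = dzLaurent f + dzLaurent g := by
  rw [dzLaurent, dzLaurent, dzLaurent, ← mul_add]
  congr 1
  ext n
  simp only [HahnSeries.coeff_add]
  ring

theorem dzLaurent_mul (f g : LaurentZ) :
    dzLaurent (f * g) = f * dzLaurent g + g * dzLaurent f := by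
  rw [dzLaurent, dzLaurent, dzLaurent, mul_left_comm f, mul_left_comm g, ← mul_add]
  congr 1
  ext n
  rw [HahnSeries.coeff_add, mul_comm g,
    HahnSeries.coeff_mul_right' g.isPWO_support (fun n hn h => hn (by simp [h])),
    HahnSeries.coeff_mul_left' f.isPWO_support (fun n hn h => hn (by simp [h])),
    ← Finset.sum_add_distrib]
  simp only [HahnSeries.coeff_mul, Finset.mul_sum]
  refine Finset.sum_congr rfl fun ij hij => ?_
  rw [← (Finset.mem_antidiagonal.1 hij).2.2]
  push_cast
  ring

/-- `∂/∂z` on `ℂ((z⁻¹))[[t]]`, coefficientwise in `t`. -/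
def dzRing (f : WaveRing) : WaveRing := fun m => dzLaurent (MvPowerSeries.coeff m f)

theorem coeff_dzRing (f : WaveRing) (m : ℕ →₀ ℕ) :
    MvPowerSeries.coeff m (dzRing f) = dzLaurent (MvPowerSeries.coeff m f) := rfl

theorem dzRing_add (f g : WaveRing) : dzRing (f + g) = dzRing f + dzRing g := by
  ext1 m
  simp only [coeff_dzRing, map_add, dzLaurent_add]

theorem dzRing_mul (f g : WaveRing) : dzRing (f * g) = f * dzRing g + g * dzRing f := by
  have hsum : ∀ (s : Finset ((ℕ →₀ ℕ) × (ℕ →₀ ℕ))) (F : (ℕ →₀ ℕ) × (ℕ →₀ ℕ) → LaurentZ),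
      dzLaurent (∑ p ∈ s, F p) = ∑ p ∈ s, dzLaurent (F p) := fun s F =>
    map_sum (AddMonoidHom.mk' dzLaurent dzLaurent_add) F s
  ext1 m
  rw [mul_comm g]
  simp only [coeff_dzRing, map_add, MvPowerSeries.coeff_mul, hsum, dzLaurent_mul,
    Finset.sum_add_distrib]
  congr 1
  exact Finset.sum_congr rfl fun p _ => mul_comm _ _

/-- `∂/∂x = ∂/∂t₀` on `ℂ((z⁻¹))[[t]]`. -/
def dxRing (f : WaveRing) : WaveRing := MvPowerSeries.pderiv LaurentZ 0 f

/-- The extension of a derivation `D` of an integral domain to its field of fractions, through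
the quotient rule `D (a / b) = (b D a - a D b) / b²`. -/
def fracDeriv {R : Type*} [CommRing R] [IsDomain R] (D : R → R) (f : FractionRing R) :
    FractionRing R :=
  let a := (IsLocalization.sec (nonZeroDivisors R) f).1
  let b := ((IsLocalization.sec (nonZeroDivisors R) f).2 : R)
  algebraMap R (FractionRing R) (b * D a - a * D b) / algebraMap R (FractionRing R) b ^ 2

/-- The quotient rule holds for every way of writing a fraction. -/
theorem fracDeriv_div {R : Type*} [CommRing R] [IsDomain R] (D : R → R)
    (hD : ∀ a b, D (a * b) = a * D b + b * D a) (a b : R) (hb : b ≠ 0) :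
    fracDeriv D (algebraMap R (FractionRing R) a / algebraMap R (FractionRing R) b) =
      algebraMap R (FractionRing R) (b * D a - a * D b) / algebraMap R (FractionRing R) b ^ 2 := by
  set f := algebraMap R (FractionRing R) a / algebraMap R (FractionRing R) b with hf
  have hs := IsLocalization.sec_spec (nonZeroDivisors R) f
  unfold fracDeriv
  set a' := (IsLocalization.sec (nonZeroDivisors R) f).1
  set b' := ((IsLocalization.sec (nonZeroDivisors R) f).2 : R)
  have hb' : b' ≠ 0 := nonZeroDivisors.ne_zero (IsLocalization.sec (nonZeroDivisors R) f).2.2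
  have inj := IsFractionRing.injective R (FractionRing R)
  have hB : algebraMap R (FractionRing R) b ≠ 0 := by
    simpa using hb
  have hB' : algebraMap R (FractionRing R) b' ≠ 0 := by
    simpa using hb'
  have key : a * b' = a' * b := by
    apply inj
    rw [map_mul, map_mul, ← hs, hf]
    field_simp
  have hD' : a * D b' + b' * D a = a' * D b + b * D a' := by
    rw [← hD, ← hD, key]
  simp only []
  rw [div_eq_div_iff (pow_ne_zero 2 hB') (pow_ne_zero 2 hB), ← map_pow, ← map_pow, ← map_mul,
    ← map_mul]
  congr 1
  linear_combination (-b * b') * hD' + (b * D b' + b' * D b) * key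

/-! ### Wave functions and correlation functions -/

/-- `ℂ[[t]][[z⁻¹]]` as a subring of the field `WaveField`. -/
def toField : FockZ →+* WaveField := (algebraMap WaveRing WaveField).comp embed

theorem toField_injective : Function.Injective toField :=
  (IsFractionRing.injective WaveRing WaveField).comp embed_injective

/-- The wave function `ψ(z;t) = τ(t - [z⁻¹]) / τ(t) · exp ϑ(z;t)`. -/
def wave (τ : Fock) : WaveField :=
  toField (shift (-1) τ) / toField (PowerSeries.C τ) *
    algebraMap WaveRing WaveField (expSeries theta)

/-- The dual wave function `ψ*(z;t) = τ(t + [z⁻¹]) / τ(t) · exp (-ϑ(z;t))`. -/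
def dualWave (τ : Fock) : WaveField :=
  toField (shift 1 τ) / toField (PowerSeries.C τ) *
    algebraMap WaveRing WaveField (expSeries (-theta))

/-- The matrix `Ψ(z;t)` with rows `(ψ, ψ*)` and `(-ψ_x, -ψ*_x)`. -/
def waveMatrix (τ : Fock) : Matrix (Fin 2) (Fin 2) WaveField :=
  !![wave τ, dualWave τ;
    -fracDeriv dxRing (wave τ), -fracDeriv dxRing (dualWave τ)]

/-- The Pauli matrix `σ₃`. -/
def sigma3 : Matrix (Fin 2) (Fin 2) WaveField := !![1, 0; 0, -1]

/-- The function `½ Tr (Ψ⁻¹ Ψ_z σ₃) - ϑ_z` of `z` and `t`. -/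
def traceFunction (τ : Fock) : WaveField :=
  1 / 2 * Matrix.trace ((waveMatrix τ)⁻¹ * (waveMatrix τ).map (fracDeriv dzRing) * sigma3)
    - algebraMap WaveRing WaveField (dzRing theta)

/-- The one-point correlation function `⟨⟨τ_k⟩⟩ = ∂ log τ / ∂t_k = (∂τ/∂t_k) / τ`, in the field of
fractions of `ℂ[[t]]` (in `ℂ[[t]]` itself when `τ(0) ≠ 0`). -/
def onePoint (τ : Fock) (k : ℕ) : FractionRing Fock :=
  algebraMap Fock (FractionRing Fock) (MvPowerSeries.pderiv ℂ k τ) /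
    algebraMap Fock (FractionRing Fock) τ

/-- The generating function `F₁(z;t) = ∑_k ⟨⟨τ_k⟩⟩ (2k+1)!! / z^(2k+2)` of one-point correlation
functions, as a formal power series in `z⁻¹`: the coefficient at `n` is `(2k+1)!! ⟨⟨τ_k⟩⟩` if
`n = 2k+2`, and it is zero if `n` is zero or odd. -/
def F1 (τ : Fock) : PowerSeries (FractionRing Fock) :=
  PowerSeries.mk fun n =>
    if Even n ∧ n ≠ 0 then (Nat.doubleFactorial (n - 1) : FractionRing Fock) * onePoint τ (n / 2 - 1)
    else 0

/-- A power series `f` in `z⁻¹` with coefficients in `Frac ℂ[[t]]`, as an element of the field of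
fractions of `ℂ((z⁻¹))[[t]]`: if the coefficients of `f` have a common denominator `d`, so that
`d f = h` with `h` in `ℂ[[t]][[z⁻¹]]`, then it is `h / d`. -/
def seriesToField (f : PowerSeries (FractionRing Fock)) : WaveField :=
  open Classical in
  if H : ∃ p : Fock × FockZ, p.1 ≠ 0 ∧
      PowerSeries.C (algebraMap Fock (FractionRing Fock) p.1) * f =
        PowerSeries.map (algebraMap Fock (FractionRing Fock)) p.2
  then toField H.choose.2 / toField (PowerSeries.C H.choose.1)
  else 0

/-- `seriesToField` does not depend on the common denominator. -/
theorem seriesToField_eq (f : PowerSeries (FractionRing Fock)) (d : Fock) (h : FockZ) (hd : d ≠ 0)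
    (hf : PowerSeries.C (algebraMap Fock (FractionRing Fock) d) * f =
      PowerSeries.map (algebraMap Fock (FractionRing Fock)) h) :
    seriesToField f = toField h / toField (PowerSeries.C d) := by
  have H : ∃ p : Fock × FockZ, p.1 ≠ 0 ∧
      PowerSeries.C (algebraMap Fock (FractionRing Fock) p.1) * f =
        PowerSeries.map (algebraMap Fock (FractionRing Fock)) p.2 := ⟨(d, h), hd, hf⟩
  rw [seriesToField, dif_pos H]
  obtain ⟨hd', hf'⟩ := H.choose_spec
  set d' := H.choose.1
  set h' := H.choose.2
  have hne : ∀ e : Fock, e ≠ 0 → toField (PowerSeries.C e) ≠ 0 := fun e he h0 =>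
    he (PowerSeries.C_injective (toField_injective (h0.trans (by simp))))
  rw [div_eq_div_iff (hne _ hd') (hne _ hd), ← map_mul, ← map_mul]
  congr 1
  apply PowerSeries.map_injective _ (IsFractionRing.injective Fock (FractionRing Fock))
  rw [map_mul, map_mul, ← hf, ← hf', PowerSeries.map_C, PowerSeries.map_C]
  ring

/-- The coefficients of `F₁` have the common denominator `τ`. -/
theorem seriesToField_F1 (τ : Fock) (hτ : τ ≠ 0) :
    seriesToField (F1 τ) = toField (PowerSeries.mk fun n =>
      if Even n ∧ n ≠ 0 then (Nat.doubleFactorial (n - 1) : Fock) *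
        MvPowerSeries.pderiv ℂ (n / 2 - 1) τ else 0) / toField (PowerSeries.C τ) := by
  refine seriesToField_eq _ _ _ hτ ?_
  have h0 : algebraMap Fock (FractionRing Fock) τ ≠ 0 := by simpa using hτ
  ext n
  rw [PowerSeries.coeff_C_mul, F1, PowerSeries.coeff_mk, PowerSeries.coeff_map,
    PowerSeries.coeff_mk]
  split_ifs
  · rw [onePoint, map_mul, map_natCast]
    field_simp
  · simp

end KdV

end

/-!
# The one-point function of a KdV tau-function from its wave functions

Write `A = τ(t - [z⁻¹])` and `B = τ(t + [z⁻¹])`.  All that is needed from the Hirota identities is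
the Wronskian identity

  `A_x B - A B_x + 2z A B = 2z τ²`,

which says that `det Ψ = ψ_x ψ* - ψ ψ*_x = 2z` (`KdV.wronskian_identity`, `KdV.det_waveMatrix`).
It is the identity with `p = 0`, evaluated at the times `t + [w⁻¹]` and `t - [w⁻¹]`.  There the
exponential factor becomes `exp (2 artanh (z/w)) = (1 + z/w) / (1 - z/w)`, and the residue of
its product with a power series `g` in `z⁻¹` is expressed by the first two coefficients of `g` and
by the value `g(w)` (`KdV.slice_one_embedSeries_mul`).  For
`g = τ(t + [w⁻¹] - [z⁻¹]) τ(t - [w⁻¹] + [z⁻¹])` this value is `τ(t)²`.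

The operator `∇ = ∑_k (2k+1)!! z^(-2k-2) ∂/∂t_k` (`KdV.grad`) is a derivation with
`F₁ = ∇ τ / τ`, and the chain rule gives `A_z = ∇ A` and `B_z = -∇ B`
(`KdV.X_sq_mul_derivative_shift`).  So `∇`, applied to the Wronskian identity, turns its left side
into an expression in the `x`- and `z`-derivatives of `A` and `B`, which is the trace
`½ Tr (Ψ⁻¹ Ψ_z σ₃)` up to the contribution `ϑ_z` of the exponentials (`KdV.trace_formula`).

For uniqueness, equal one-point functions mean `∂ₖρ τ = ρ ∂ₖτ` for all `k`.  Leading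
monomials show that two such series are proportional
(`MvPowerSeries.exists_eq_C_mul_of_pderiv_mul_eq`), also when they vanish at `t = 0`.  Equal wave
functions reduce to this case: the `z`-derivative of `ρ(t - [z⁻¹]) τ = τ(t - [z⁻¹]) ρ` is the
identity `∑_k (2k+1)!! z^(-2k-2) u_k(t - [z⁻¹]) = 0` with `u_k = ∂ₖρ τ - ρ ∂ₖτ`, and the `u_k`
vanish one after the other (`KdV.pderiv_mul_eq_of_grad_shift`).
-/

noncomputable section

/-! ### Formal power series in infinitely many variables -/

namespace MvPowerSeries

variable {σ ι R : Type*}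

/-- Two maps that are continuous for the product topology agree on all power series as soon as
they agree on polynomials. -/
theorem eq_of_eq_on_mvPolynomial [CommSemiring R] [TopologicalSpace R] {Y : Type*}
    [TopologicalSpace Y] [T2Space Y] {F G : MvPowerSeries σ R → Y}
    (hF : @Continuous _ _ (WithPiTopology.instTopologicalSpace R) _ F)
    (hG : @Continuous _ _ (WithPiTopology.instTopologicalSpace R) _ G)
    (h : ∀ p : MvPolynomial σ R, F p = G p) : F = G :=
  letI := WithPiTopology.instTopologicalSpace (σ := σ) R
  WithPiTopology.denseRange_toMvPowerSeries.equalizer hF hG (funext h)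

/-- Two power series with the same logarithmic derivatives have the same leading monomial, for any
monomial order: comparing leading coefficients in `∂ₖf g = f ∂ₖg` gives `a k = b k`. -/
theorem monomial_eq_of_pderiv_mul_eq [CommRing R] [IsDomain R] [CharZero R] (m : MonomialOrder σ)
    {f g : MvPowerSeries σ R} (h : ∀ k, pderiv R k f * g = f * pderiv R k g) {a b : σ →₀ ℕ}
    (ha : coeff a f ≠ 0) (ha' : ∀ e, coeff e f ≠ 0 → m.toSyn a ≤ m.toSyn e)
    (hb : coeff b g ≠ 0) (hb' : ∀ e, coeff e g ≠ 0 → m.toSyn b ≤ m.toSyn e) : a = b := by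
  classical
  -- the coefficient of `∂ₖu · w` at `c + d - eₖ`, where `c`, `d` are the leading exponents
  have key : ∀ {u w : MvPowerSeries σ R} {c d : σ →₀ ℕ} (k : σ) (r : σ →₀ ℕ),
      (∀ e, coeff e u ≠ 0 → m.toSyn c ≤ m.toSyn e) →
      (∀ e, coeff e w ≠ 0 → m.toSyn d ≤ m.toSyn e) → c + d = r + Finsupp.single k 1 →
      coeff r (pderiv R k u * w) = coeff c u * coeff d w * (c k : R) := by
    intro u w c d k r hu hw hr
    rw [coeff_mul]
    have hzero : ∀ p ∈ Finset.HasAntidiagonal.antidiagonal r, coeff p.1 (pderiv R k u) * coeff p.2 w ≠ 0 →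
        p.1 + Finsupp.single k 1 = c ∧ p.2 = d := by
      intro p hp hne
      rw [Finset.HasAntidiagonal.mem_antidiagonal] at hp
      rw [coeff_pderiv] at hne
      have h1 := hu _ (left_ne_zero_of_mul (left_ne_zero_of_mul hne))
      have h2 := hw _ (right_ne_zero_of_mul hne)
      have hs : m.toSyn (p.1 + Finsupp.single k 1) + m.toSyn p.2 = m.toSyn c + m.toSyn d := by
        rw [← map_add, ← map_add, hr, ← hp]
        congr 1
        abel
      have h3 : m.toSyn c = m.toSyn (p.1 + Finsupp.single k 1) := by
        refine le_antisymm h1 (le_of_not_gt fun hlt => ?_)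
        exact (add_lt_add_of_lt_of_le hlt h2).ne hs.symm
      have h4 : m.toSyn d = m.toSyn p.2 := by
        rw [h3] at hs
        exact (add_left_cancel hs).symm
      exact ⟨m.toSyn.injective h3.symm, m.toSyn.injective h4.symm⟩
    by_cases hk : c k = 0
    · rw [hk, Nat.cast_zero, mul_zero]
      refine Finset.sum_eq_zero fun p hp => ?_
      by_contra hne
      have := (hzero p hp hne).1
      rw [← this] at hk
      simp at hk
    · have hc : c - Finsupp.single k 1 + Finsupp.single k 1 = c := by
        ext i
        by_cases hi : i = k
        · subst hi
          simp
          omega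
        · simp [Ne.symm hi]
      rw [Finset.sum_eq_single (c - Finsupp.single k 1, d)]
      · rw [coeff_pderiv, hc]
        have : (((c - Finsupp.single k 1 : σ →₀ ℕ) k : ℕ) : R) + 1 = c k := by
          have : (c - Finsupp.single k 1 : σ →₀ ℕ) k + 1 = c k := by
            simp
            omega
          exact_mod_cast this
        rw [this]
        ring
      · intro p hp hne
        by_contra hne'
        obtain ⟨h1, h2⟩ := hzero p hp hne'
        exact hne (Prod.ext (by rw [← h1]; simp) h2)
      · intro hp
        refine absurd ?_ hp
        rw [Finset.HasAntidiagonal.mem_antidiagonal]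
        apply add_right_cancel (b := Finsupp.single k 1)
        rw [← hr, add_right_comm, hc]
  ext k
  by_cases hk : a k = 0 ∧ b k = 0
  · rw [hk.1, hk.2]
  have hr : a + b = (a + b - Finsupp.single k 1) + Finsupp.single k 1 := by
    ext i
    by_cases hi : i = k
    · subst hi
      simp
      omega
    · simp [Ne.symm hi]
  have h1 := key k _ ha' hb' hr
  have h2 := key k _ hb' ha' ((add_comm b a).trans hr)
  rw [h k, mul_comm f, h2, mul_comm (coeff b g)] at h1
  exact_mod_cast (mul_left_cancel₀ (mul_ne_zero ha hb) h1).symm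

/-- Two power series with the same logarithmic derivatives are proportional: if `c` is the quotient
of their coefficients at the leading monomial of `g`, then `f - c g` cannot have that leading
monomial, and so it vanishes. -/
theorem exists_eq_C_mul_of_pderiv_mul_eq {K : Type*} [Field K] [CharZero K]
    (m : MonomialOrder σ) {f g : MvPowerSeries σ K} (hf : f ≠ 0) (hg : g ≠ 0)
    (h : ∀ k, pderiv K k f * g = f * pderiv K k g) : ∃ c : K, c ≠ 0 ∧ f = C c * g := by
  have lead : ∀ u : MvPowerSeries σ K, u ≠ 0 → ∃ a, coeff a u ≠ 0 ∧
      ∀ e, coeff e u ≠ 0 → m.toSyn a ≤ m.toSyn e := by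
    intro u hu
    obtain ⟨e, he⟩ : ∃ e, coeff e u ≠ 0 := by
      by_contra! hc
      exact hu (MvPowerSeries.ext hc)
    obtain ⟨a, ha, hmin⟩ := (InvImage.wf m.toSyn wellFounded_lt).has_min
      {e | coeff e u ≠ 0} ⟨e, he⟩
    exact ⟨a, ha, fun e he => le_of_not_gt (hmin e he)⟩
  obtain ⟨b, hb, hb'⟩ := lead g hg
  set c := coeff b f / coeff b g with hc
  have heq : f = C c * g := by
    by_contra hne
    obtain ⟨a, ha, ha'⟩ := lead (f - C c * g) (sub_ne_zero.2 hne)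
    have hab : a = b := monomial_eq_of_pderiv_mul_eq m (fun k => by
      rw [map_sub, Derivation.leibniz, pderiv_C, smul_zero, add_zero, smul_eq_mul]
      linear_combination h k) ha ha' hb hb'
    rw [hab] at ha
    apply ha
    rw [map_sub, coeff_C_mul, hc]
    field_simp
    ring
  refine ⟨c, ?_, heq⟩
  rintro h0
  rw [h0, map_zero, zero_mul] at heq
  exact hf heq

end MvPowerSeries

end

noncomputable section

/-! ### Substitutions and the distinguished variable -/

namespace MvPowerSeries

variable {σ ι R : Type*} [CommRing R]

theorem continuous_coeff_subst [UniformSpace R] [DiscreteUniformity R]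
    {a : σ → MvPowerSeries ι R} (ha : HasSubst a) (d : ι →₀ ℕ) :
    @Continuous _ _ (WithPiTopology.instTopologicalSpace R) _
      fun f : MvPowerSeries σ R => coeff d (subst a f) := by
  let := WithPiTopology.instTopologicalSpace (σ := σ) R
  let := WithPiTopology.instTopologicalSpace (σ := ι) R
  exact (WithPiTopology.continuous_coeff R d).comp (continuous_subst ha)

theorem continuous_coeff_pderiv [TopologicalSpace R] [IsTopologicalSemiring R] (k : σ)
    (d : σ →₀ ℕ) : @Continuous _ _ (WithPiTopology.instTopologicalSpace R) _
      fun f : MvPowerSeries σ R => coeff d (pderiv R k f) := by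
  let := WithPiTopology.instTopologicalSpace (σ := σ) R
  simp only [coeff_pderiv]
  exact (WithPiTopology.continuous_coeff R _).mul continuous_const

theorem _root_.Finsupp.optionElim_zero_eq_embDomain (x : σ →₀ ℕ) :
    Finsupp.optionElim 0 x = Finsupp.embDomain Function.Embedding.some x := by
  refine Finsupp.ext fun o => ?_
  rcases o with _ | i
  · rw [Finsupp.optionElim_apply_none, Finsupp.embDomain_of_notMem_range _ _ _ (by simp)]
  · rw [Finsupp.optionElim_apply_some]
    exact (Finsupp.embDomain_apply_self Function.Embedding.some x i).symm

theorem optionEquivLeft_rename_some (f : MvPowerSeries σ R) :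
    optionEquivLeft σ R (rename Function.Embedding.some f) = PowerSeries.C f := by
  ext n x
  rw [coeff_coeff_optionEquivLeft, PowerSeries.coeff_C]
  split_ifs with hn
  · rw [hn, Finsupp.optionElim_zero_eq_embDomain, coeff_embDomain_rename]
  · rw [map_zero]
    refine coeff_rename_eq_zero _ _ ?_
    rintro ⟨y, hy⟩
    have := DFunLike.congr_fun hy none
    rw [Finsupp.mapDomain_of_notMem_range _ _ (by simp), Finsupp.optionElim_apply_none] at this
    exact hn this.symm

/-- The extension of a substitution `a` by the identity on an additional variable. -/
def optionSubst (a : σ → MvPowerSeries ι R) : Option σ → MvPowerSeries (Option ι) R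
  | none => X none
  | some i => rename Function.Embedding.some (a i)

theorem hasSubst_optionSubst {a : σ → MvPowerSeries ι R} (ha : HasSubst a) :
    HasSubst (optionSubst a) where
  const_coeff i := by
    rcases i with _ | i
    · simp [optionSubst]
    · simpa [optionSubst] using ha.const_coeff i
  coeff_zero d := by
    classical
    refine ((Set.finite_singleton none).union
      ((ha.coeff_zero d.some).image some)).subset ?_
    rintro (_ | i) hi
    · simp
    · right
      refine ⟨i, ?_, rfl⟩
      simp only [optionSubst, Set.mem_ofPred_eq] at hi ⊢
      contrapose! hi
      have h := coeff_coeff_optionEquivLeft (rename Function.Embedding.some (a i)) (d none) d.some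
      have hd : Finsupp.optionElim (d none) d.some = d := by
        ext (_ | _) <;> simp
      rw [hd, optionEquivLeft_rename_some, PowerSeries.coeff_C] at h
      rw [← h]
      split_ifs
      · exact hi
      · simp

theorem map_subst_optionEquivLeft {a : σ → MvPowerSeries ι R} (ha : HasSubst a)
    (f : MvPowerSeries (Option σ) R) :
    PowerSeries.map (substAlgHom (R := R) ha : MvPowerSeries σ R →+* MvPowerSeries ι R)
        (optionEquivLeft σ R f) =
      optionEquivLeft ι R (subst (optionSubst a) f) := by
  let : UniformSpace R := ⊥
  have : DiscreteUniformity R := ⟨rfl⟩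
  let := WithPiTopology.instTopologicalSpace (σ := Option σ) R
  let := WithPiTopology.instTopologicalSpace (σ := σ) R
  let := WithPiTopology.instTopologicalSpace (σ := ι) R
  ext n x
  rw [coeff_coeff_optionEquivLeft]
  refine congrFun (eq_of_eq_on_mvPolynomial
    (F := fun f => coeff x (PowerSeries.coeff n (PowerSeries.map (substAlgHom (R := R) ha :
      MvPowerSeries σ R →+* MvPowerSeries ι R) (optionEquivLeft σ R f))))
    ?_ (continuous_coeff_subst (hasSubst_optionSubst ha) _) fun p => ?_) f
  · simp only [PowerSeries.coeff_map]
    have h1 : Continuous fun f : MvPowerSeries (Option σ) R =>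
        PowerSeries.coeff n (optionEquivLeft σ R f) := by
      refine continuous_pi fun y => ?_
      refine (WithPiTopology.continuous_coeff (σ := Option σ) R (Finsupp.optionElim n y)).congr
        fun f => ?_
      exact (coeff_coeff_optionEquivLeft f n y).symm
    have h2 := (continuous_coeff_subst ha x).comp h1
    simpa [Function.comp_def, substAlgHom_apply] using h2
  · refine Eq.trans ?_ (coeff_coeff_optionEquivLeft _ n x)
    refine congrArg (fun g => coeff x (PowerSeries.coeff n g)) ?_
    have hs := hasSubst_optionSubst ha
    rw [← substAlgHom_apply hs]
    induction p using MvPolynomial.induction_on with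
    | C r => 
      rw [MvPolynomial.coe_C, optionEquivLeft_C, PowerSeries.map_C, substAlgHom_apply, subst_C,
        optionEquivLeft_C, RingHom.coe_coe, substAlgHom_apply, subst_C]
    | add p q hp hq => simp only [MvPolynomial.coe_add, map_add, hp, hq]
    | mul_X p i hp =>
      rw [MvPolynomial.coe_mul, map_mul, map_mul, map_mul, map_mul, hp, MvPolynomial.coe_X]
      congr 1
      rw [substAlgHom_X]
      rcases i with _ | i
      · simp [optionSubst]
      · rw [optionEquivLeft_X_some, PowerSeries.map_C, optionSubst, optionEquivLeft_rename_some,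
          RingHom.coe_coe, substAlgHom_X]

/-! #### Evaluation of a power series at one of the variables of its coefficients -/

/-- The substitution of `X i` for the variable of a power series over `R[[X]]`, as a
substitution for the variables `Option σ`. -/
def diagonalSubst (R : Type*) [CommRing R] (i : σ) : Option σ → MvPowerSeries σ R
  | none => X i
  | some j => X j

theorem hasSubst_diagonalSubst (i : σ) : HasSubst (diagonalSubst R i) where
  const_coeff j := by rcases j with _ | j <;> simp [diagonalSubst]
  coeff_zero d := by
    classical
    refine ((Set.finite_singleton none).union (d.support.finite_toSet.image some)).subset ?_
    rintro (_ | j) hj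
    · simp
    · right
      refine ⟨j, ?_, rfl⟩
      simp only [diagonalSubst, Set.mem_ofPred_eq, coeff_X] at hj
      have : d = Finsupp.single j 1 := by
        by_contra h
        simp [h] at hj
      simp [this]

/-- Evaluation `f ↦ f(X i)` of a power series with coefficients in `R[[X]]`. -/
def evalDiagonal (i : σ) : PowerSeries (MvPowerSeries σ R) →ₐ[R] MvPowerSeries σ R :=
  (substAlgHom (hasSubst_diagonalSubst i)).comp (optionEquivLeft σ R).symm.toAlgHom

theorem evalDiagonal_optionEquivLeft (i : σ) (f : MvPowerSeries (Option σ) R) :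
    evalDiagonal i (optionEquivLeft σ R f) = subst (diagonalSubst R i) f := by
  change substAlgHom (hasSubst_diagonalSubst i) ((optionEquivLeft σ R).symm (optionEquivLeft σ R f)) = _
  rw [AlgEquiv.symm_apply_apply, substAlgHom_apply]

theorem subst_rename_some {a : Option σ → MvPowerSeries ι R} (ha : HasSubst a)
    (f : MvPowerSeries σ R) :
    subst a (rename Function.Embedding.some f) = subst (fun i => a (some i)) f := by
  rw [rename_eq_subst, subst_comp_subst_apply (HasSubst.X_comp _) ha]
  congr 1
  funext i
  exact subst_X ha _

theorem evalDiagonal_C (i : σ) (c : MvPowerSeries σ R) :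
    evalDiagonal i (PowerSeries.C c) = c := by
  rw [← optionEquivLeft_rename_some, evalDiagonal_optionEquivLeft,
    subst_rename_some (hasSubst_diagonalSubst i)]
  exact congrFun subst_self c

theorem evalDiagonal_X (i : σ) :
    evalDiagonal i (PowerSeries.X : PowerSeries (MvPowerSeries σ R)) = X i := by
  rw [← optionEquivLeft_X_none, evalDiagonal_optionEquivLeft, subst_X (hasSubst_diagonalSubst i)]
  rfl

/-- The translation `X none ↦ X none + r X (some i)`. -/
def translateSubst (i : σ) (r : R) : Option σ → MvPowerSeries (Option σ) R
  | none => X none + C r * X (some i)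
  | some j => X (some j)

theorem hasSubst_translateSubst (i : σ) (r : R) : HasSubst (translateSubst i r) where
  const_coeff j := by rcases j with _ | j <;> simp [translateSubst]
  coeff_zero d := by
    classical
    refine ((Set.finite_singleton none).union d.support.finite_toSet).subset ?_
    rintro (_ | j) hj
    · simp
    · right
      simp only [translateSubst, Set.mem_ofPred_eq, coeff_X] at hj
      have : d = Finsupp.single (some j) 1 := by
        by_contra h
        simp [h] at hj
      simp [this]

/-- The factor theorem for power series: `f - f(X i)` is divisible by the difference of the
variable and `X i`.  After a translation of the variable, it is divisibility by the variable. -/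
theorem exists_eq_C_evalDiagonal_add (i : σ) (f : PowerSeries (MvPowerSeries σ R)) :
    ∃ q, f = PowerSeries.C (evalDiagonal i f) + (PowerSeries.X - PowerSeries.C (X i)) * q := by
  set φ := optionEquivLeft σ R
  let T : R → PowerSeries (MvPowerSeries σ R) → PowerSeries (MvPowerSeries σ R) :=
    fun r g => φ (substAlgHom (hasSubst_translateSubst i r) (φ.symm g))
  have hC : ∀ r c, T r (PowerSeries.C c) = PowerSeries.C c := by
    intro r c
    have : φ.symm (PowerSeries.C c) = rename Function.Embedding.some c := by
      rw [AlgEquiv.symm_apply_eq]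
      exact (optionEquivLeft_rename_some c).symm
    simp only [T]
    rw [this, substAlgHom_apply, subst_rename_some (hasSubst_translateSubst i r)]
    change φ (subst (X ∘ Function.Embedding.some) c) = _
    rw [← rename_eq_subst]
    exact optionEquivLeft_rename_some c
  have hX : T (-1) PowerSeries.X = PowerSeries.X - PowerSeries.C (X i) := by
    have : φ.symm PowerSeries.X = X none := by
      rw [AlgEquiv.symm_apply_eq]
      exact optionEquivLeft_X_none.symm
    simp only [T]
    rw [this, substAlgHom_X, translateSubst, map_add, map_mul]
    simp only [φ]
    rw [optionEquivLeft_X_none, optionEquivLeft_X_some, optionEquivLeft_C]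
    simp [sub_eq_add_neg]
  have hinv : T (-1) (T 1 f) = f := by
    simp only [T]
    rw [AlgEquiv.symm_apply_apply, substAlgHom_apply, substAlgHom_apply,
      subst_comp_subst_apply (hasSubst_translateSubst i 1) (hasSubst_translateSubst i (-1))]
    have : (fun s => subst (translateSubst i (-1 : R)) (translateSubst i (1 : R) s)) = X := by
      funext s
      rw [← substAlgHom_apply (hasSubst_translateSubst i (-1))]
      rcases s with _ | s
      · rw [translateSubst, map_add, map_one, one_mul, substAlgHom_X, substAlgHom_X,
          translateSubst, translateSubst]
        simp
      · rw [translateSubst, substAlgHom_X, translateSubst]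
    rw [this, subst_self, id, AlgEquiv.apply_symm_apply]
  obtain ⟨q, hq⟩ : PowerSeries.X ∣ T 1 f - PowerSeries.C (PowerSeries.constantCoeff (T 1 f)) := by
    rw [PowerSeries.X_dvd_iff]
    simp
  have hf : f = PowerSeries.C (PowerSeries.constantCoeff (T 1 f))
      + (PowerSeries.X - PowerSeries.C (X i)) * T (-1) q := by
    have h1 : T 1 f = PowerSeries.C (PowerSeries.constantCoeff (T 1 f)) + PowerSeries.X * q := by
      rw [← hq]
      ring
    have h2 := congrArg (T (-1)) h1
    have hadd : ∀ g h, T (-1) (g + h) = T (-1) g + T (-1) h := fun g h => by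
      simp only [T, map_add]
    have hmul : ∀ g h, T (-1) (g * h) = T (-1) g * T (-1) h := fun g h => by
      simp only [T, map_mul]
    rwa [hinv, hadd, hmul, hC, hX] at h2
  have he : evalDiagonal i f = PowerSeries.constantCoeff (T 1 f) := by
    conv_lhs => rw [hf]
    rw [map_add, map_mul, map_sub, evalDiagonal_C, evalDiagonal_C, evalDiagonal_X, sub_self,
      zero_mul, add_zero]
  exact ⟨T (-1) q, by rw [he]; exact hf⟩

end MvPowerSeries

end

noncomputable section

/-! ### Series whose coefficients are Laurent series in `z⁻¹` -/

namespace KdV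

open MvPowerSeries

variable {σ ι : Type*}

/-- The coefficient of `z⁻ⁿ` of a series in `ℂ((z⁻¹))[[t]]`. -/
def slice (n : ℤ) : MvPowerSeries σ LaurentZ →+ MvPowerSeries σ ℂ where
  toFun f := fun m => (MvPowerSeries.coeff m f).coeff n
  map_zero' := rfl
  map_add' _ _ := rfl

theorem coeff_slice (n : ℤ) (f : MvPowerSeries σ LaurentZ) (m : σ →₀ ℕ) :
    MvPowerSeries.coeff m (slice n f) = (MvPowerSeries.coeff m f).coeff n := rfl

theorem ext_slice {f g : MvPowerSeries σ LaurentZ} (h : ∀ n, slice n f = slice n g) : f = g := by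
  ext m n
  exact congrArg (MvPowerSeries.coeff m) (h n)

theorem slice_mul_map_C (n : ℤ) (f : MvPowerSeries σ LaurentZ) (c : MvPowerSeries σ ℂ) :
    slice n (MvPowerSeries.map HahnSeries.C c * f) = c * slice n f := by
  classical
  ext m
  rw [coeff_slice, MvPowerSeries.coeff_mul, MvPowerSeries.coeff_mul, HahnSeries.coeff_sum]
  refine Finset.sum_congr rfl fun p _ => ?_
  rw [MvPowerSeries.coeff_map, coeff_slice, HahnSeries.C_mul_eq_smul, HahnSeries.coeff_smul,
    smul_eq_mul]

theorem slice_C_single_mul (n k : ℤ) (f : MvPowerSeries σ LaurentZ) :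
    slice (n + k) (MvPowerSeries.C (HahnSeries.single k 1) * f) = slice n f := by
  ext m
  rw [coeff_slice, MvPowerSeries.coeff_C_mul, HahnSeries.coeff_single_mul_add, one_mul,
    coeff_slice]

/-- Substitution of series that do not involve `z` acts on each power of `z` separately. -/
theorem slice_subst {a : σ → MvPowerSeries ι ℂ} (ha : HasSubst a) (n : ℤ)
    (f : MvPowerSeries σ LaurentZ) :
    slice n (f.subst fun i => MvPowerSeries.map HahnSeries.C (a i)) = subst a (slice n f) := by
  have ha' : HasSubst fun i => MvPowerSeries.map (HahnSeries.C : ℂ →+* LaurentZ) (a i) :=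
    ha.map _
  ext m
  have hco : ∀ d : σ →₀ ℕ, MvPowerSeries.coeff m (d.prod fun i e =>
      MvPowerSeries.map (HahnSeries.C : ℂ →+* LaurentZ) (a i) ^ e) =
      HahnSeries.C (MvPowerSeries.coeff m (d.prod fun i e => a i ^ e)) := by
    intro d
    rw [← MvPowerSeries.coeff_map]
    refine congrArg _ ?_
    simp only [Finsupp.prod, map_prod, map_pow]
  rw [coeff_slice, coeff_subst ha', coeff_subst ha]
  have h := AddMonoidHom.map_finsum (AddMonoidHom.mk' (fun x : LaurentZ => x.coeff n) fun _ _ => rfl)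
    (coeff_subst_finite ha' f m)
  refine h.trans (finsum_congr fun d => ?_)
  rw [hco, smul_eq_mul, mul_comm, AddMonoidHom.mk'_apply, HahnSeries.C_mul_eq_smul,
    HahnSeries.coeff_smul, smul_eq_mul, smul_eq_mul, coeff_slice, mul_comm]

/-- The map underlying `embedSeries`. -/
def embedSeriesFun (f : PowerSeries (MvPowerSeries σ ℂ)) : MvPowerSeries σ LaurentZ :=
  fun m => HahnSeries.ofPowerSeries ℤ ℂ
    (PowerSeries.mk fun n => MvPowerSeries.coeff m (PowerSeries.coeff n f))

theorem slice_embedSeriesFun (n : ℤ) (f : PowerSeries (MvPowerSeries σ ℂ)) :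
    slice n (embedSeriesFun f) = if n < 0 then 0 else PowerSeries.coeff n.natAbs f := by
  ext m
  change (HahnSeries.ofPowerSeries ℤ ℂ _).coeff n = _
  rw [PowerSeries.coeff_coe]
  split_ifs
  · rw [map_zero]
  · rw [PowerSeries.coeff_mk]

theorem coeff_embedSeriesFun (f : PowerSeries (MvPowerSeries σ ℂ)) (m : σ →₀ ℕ) :
    MvPowerSeries.coeff m (embedSeriesFun f) = HahnSeries.ofPowerSeries ℤ ℂ
      (PowerSeries.mk fun n => MvPowerSeries.coeff m (PowerSeries.coeff n f)) := rfl

theorem embedSeriesFun_C (c : MvPowerSeries σ ℂ) :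
    embedSeriesFun (PowerSeries.C c) = MvPowerSeries.map HahnSeries.C c := by
  refine ext_slice fun n => ?_
  rw [slice_embedSeriesFun, PowerSeries.coeff_C]
  ext m
  rw [coeff_slice, MvPowerSeries.coeff_map, HahnSeries.C_apply, HahnSeries.coeff_single]
  split_ifs <;> first | rfl | (exfalso; omega)

/-- The inclusion `R[[z⁻¹]] → ℂ((z⁻¹))[[t]]` for `R = ℂ[[t]]` and an arbitrary set of times. -/
def embedSeries (σ : Type*) : PowerSeries (MvPowerSeries σ ℂ) →+* MvPowerSeries σ LaurentZ where
  toFun := embedSeriesFun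
  map_one' := by
    rw [← map_one PowerSeries.C, embedSeriesFun_C, map_one]
  map_mul' f g := by
    classical
    refine MvPowerSeries.ext fun m => ?_
    simp_rw [MvPowerSeries.coeff_mul, coeff_embedSeriesFun, ← map_mul]
    rw [← map_sum]
    congr 1
    ext n
    rw [PowerSeries.coeff_mk, PowerSeries.coeff_mul, map_sum, map_sum]
    simp_rw [MvPowerSeries.coeff_mul, PowerSeries.coeff_mul, PowerSeries.coeff_mk]
    rw [Finset.sum_comm]
  map_zero' := by
    rw [← map_zero PowerSeries.C, embedSeriesFun_C, map_zero]
  map_add' f g := by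
    refine ext_slice fun n => ?_
    rw [map_add, slice_embedSeriesFun, slice_embedSeriesFun, slice_embedSeriesFun]
    split_ifs
    · rw [add_zero]
    · rw [map_add]

theorem slice_embedSeries (n : ℤ) (f : PowerSeries (MvPowerSeries σ ℂ)) :
    slice n (embedSeries σ f) = if n < 0 then 0 else PowerSeries.coeff n.natAbs f :=
  slice_embedSeriesFun n f

theorem embedSeries_C (c : MvPowerSeries σ ℂ) :
    embedSeries σ (PowerSeries.C c) = MvPowerSeries.map HahnSeries.C c :=
  embedSeriesFun_C c

theorem embed_eq_embedSeries : embed = embedSeries ℕ := rfl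

theorem embedSeries_X :
    embedSeries σ PowerSeries.X = MvPowerSeries.C (HahnSeries.single 1 1) := by
  classical
  refine ext_slice fun n => ?_
  rw [slice_embedSeries, PowerSeries.coeff_X]
  ext m
  rw [coeff_slice, MvPowerSeries.coeff_C]
  by_cases hm : m = 0
  · rw [if_pos hm, HahnSeries.coeff_single, hm]
    split_ifs <;> first | (exfalso; omega) | simp
  · rw [if_neg hm, HahnSeries.coeff_zero]
    split_ifs
    · simp
    · rw [MvPowerSeries.coeff_one, if_neg hm]
    · simp

theorem subst_embedSeries {a : σ → MvPowerSeries ι ℂ} (ha : HasSubst a)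
    (f : PowerSeries (MvPowerSeries σ ℂ)) :
    (embedSeries σ f).subst (fun i => MvPowerSeries.map HahnSeries.C (a i)) =
      embedSeries ι (PowerSeries.map
        (substAlgHom (R := ℂ) ha : MvPowerSeries σ ℂ →+* MvPowerSeries ι ℂ) f) := by
  refine ext_slice fun n => ?_
  rw [slice_subst ha, slice_embedSeries, slice_embedSeries, PowerSeries.coeff_map, RingHom.coe_coe,
    substAlgHom_apply]
  split_ifs
  · rw [← substAlgHom_apply ha, map_zero]
  · rfl

end KdV

end

noncomputable section

/-! ### The shift of the times and its derivatives -/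

namespace KdV

open MvPowerSeries

/-- The substitution `t_k ↦ t_k + ε (2k-1)!! z^(-2k-1)`; the variable `X none` is `z⁻¹`. -/
def shiftSubst (ε : ℂ) : ℕ → MvPowerSeries (Option ℕ) ℂ := fun k =>
  X (some k) + (ε * (Nat.doubleFactorial (2 * k - 1) : ℂ)) • X none ^ (2 * k + 1)

theorem hasSubst_shiftSubst (ε : ℂ) : HasSubst (shiftSubst ε) := hasSubst_shift ε

/-- `shift ε` as an algebra homomorphism. -/
def shiftHom (ε : ℂ) : Fock →ₐ[ℂ] FockZ :=
  (optionEquivLeft ℕ ℂ).toAlgHom.comp (substAlgHom (hasSubst_shiftSubst ε))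

theorem shiftHom_apply (ε : ℂ) (f : Fock) : shiftHom ε f = shift ε f := by
  change optionEquivLeft ℕ ℂ (substAlgHom (hasSubst_shiftSubst ε) f) = _
  rw [substAlgHom_apply]
  rfl

theorem shiftHom_C (ε r : ℂ) :
    shiftHom ε (MvPowerSeries.C r) = PowerSeries.C (MvPowerSeries.C r) := by
  change optionEquivLeft ℕ ℂ (substAlgHom (hasSubst_shiftSubst ε) _) = _
  rw [substAlgHom_apply, subst_C, optionEquivLeft_C]

theorem shiftHom_X (ε : ℂ) (k : ℕ) :
    shiftHom ε (X k) = PowerSeries.C (X k) + PowerSeries.C (MvPowerSeries.C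
      (ε * (Nat.doubleFactorial (2 * k - 1) : ℂ))) * PowerSeries.X ^ (2 * k + 1) := by
  change optionEquivLeft ℕ ℂ (substAlgHom (hasSubst_shiftSubst ε) _) = _
  rw [substAlgHom_X, shiftSubst, map_add, optionEquivLeft_X_some, MvPowerSeries.smul_eq_C_mul,
    map_mul, map_pow, optionEquivLeft_X_none, optionEquivLeft_C]

/-- The derivation `∂/∂t_k` on `ℂ[[t]][[z⁻¹]]`. -/
def timeDeriv (k : ℕ) : FockZ →+ FockZ where
  toFun f := PowerSeries.mk fun n => pderiv ℂ k (PowerSeries.coeff n f)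
  map_zero' := by ext1 n; simp
  map_add' f g := by ext1 n; simp

theorem coeff_timeDeriv (k n : ℕ) (f : FockZ) :
    PowerSeries.coeff n (timeDeriv k f) = pderiv ℂ k (PowerSeries.coeff n f) := by
  change PowerSeries.coeff n (PowerSeries.mk fun n => pderiv ℂ k (PowerSeries.coeff n f)) = _
  rw [PowerSeries.coeff_mk]

theorem timeDeriv_mul (k : ℕ) (f g : FockZ) :
    timeDeriv k (f * g) = f * timeDeriv k g + g * timeDeriv k f := by
  rw [mul_comm g]
  ext1 n
  simp only [coeff_timeDeriv, map_add, PowerSeries.coeff_mul, map_sum, Derivation.leibniz,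
    Finset.sum_add_distrib, smul_eq_mul]
  congr 1
  exact Finset.sum_congr rfl fun p _ => mul_comm _ _

theorem timeDeriv_C (k : ℕ) (f : Fock) :
    timeDeriv k (PowerSeries.C f) = PowerSeries.C (pderiv ℂ k f) := by
  ext1 n
  rw [coeff_timeDeriv, PowerSeries.coeff_C, PowerSeries.coeff_C]
  split_ifs <;> simp

theorem timeDeriv_X_pow (k n : ℕ) : timeDeriv k (PowerSeries.X ^ n) = 0 := by
  ext1 i
  rw [coeff_timeDeriv, PowerSeries.coeff_X_pow]
  split_ifs <;> simp

/-- The truncation `∑_{k < N} (2k+1)!! z^(-2k-2) ∂/∂t_k` of `grad`. -/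
def gradTrunc (N : ℕ) : FockZ →+ FockZ :=
  ∑ k ∈ Finset.range N, (AddMonoidHom.mulLeft
    ((Nat.doubleFactorial (2 * k + 1) : FockZ) * PowerSeries.X ^ (2 * k + 2))).comp (timeDeriv k)

theorem gradTrunc_apply (N : ℕ) (f : FockZ) : gradTrunc N f = ∑ k ∈ Finset.range N,
    (Nat.doubleFactorial (2 * k + 1) : FockZ) * PowerSeries.X ^ (2 * k + 2) * timeDeriv k f := by
  simp [gradTrunc]

/-- The derivation `∑_k (2k+1)!! z^(-2k-2) ∂/∂t_k` of `ℂ[[t]][[z⁻¹]]`, whose value on `log τ` is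
the generating function of one-point functions.  Only `k < n` contribute to the coefficient
of `z⁻ⁿ`. -/
def grad (f : FockZ) : FockZ := PowerSeries.mk fun n => PowerSeries.coeff n (gradTrunc n f)

theorem coeff_gradTrunc (N n : ℕ) (f : FockZ) :
    PowerSeries.coeff n (gradTrunc N f) = ∑ k ∈ Finset.range N, if 2 * k + 2 ≤ n then
      (Nat.doubleFactorial (2 * k + 1) : Fock) * pderiv ℂ k (PowerSeries.coeff (n - (2 * k + 2)) f)
      else 0 := by
  rw [gradTrunc_apply, map_sum]
  refine Finset.sum_congr rfl fun k _ => ?_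
  rw [mul_assoc, ← map_natCast (PowerSeries.C (R := Fock)), PowerSeries.coeff_C_mul,
    PowerSeries.coeff_X_pow_mul']
  split_ifs
  · rw [coeff_timeDeriv]
  · rw [mul_zero]

theorem coeff_grad {n N : ℕ} (h : n ≤ N) (f : FockZ) :
    PowerSeries.coeff n (grad f) = PowerSeries.coeff n (gradTrunc N f) := by
  rw [grad, PowerSeries.coeff_mk, coeff_gradTrunc, coeff_gradTrunc]
  refine Finset.sum_subset (Finset.range_mono h) fun k _ hk => if_neg ?_
  rw [Finset.mem_range] at hk
  omega

theorem grad_add (f g : FockZ) : grad (f + g) = grad f + grad g := by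
  ext1 n
  rw [map_add, coeff_grad le_rfl, coeff_grad le_rfl, coeff_grad le_rfl, map_add, map_add]

theorem grad_mul (f g : FockZ) : grad (f * g) = f * grad g + g * grad f := by
  have hN : ∀ N, gradTrunc N (f * g) = f * gradTrunc N g + g * gradTrunc N f := by
    intro N
    simp only [gradTrunc_apply, timeDeriv_mul, Finset.mul_sum]
    rw [← Finset.sum_add_distrib]
    exact Finset.sum_congr rfl fun k _ => by ring
  ext1 n
  rw [coeff_grad le_rfl, hN, map_add, map_add]
  simp only [PowerSeries.coeff_mul]
  congr 1 <;> exact Finset.sum_congr rfl fun p hp => by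
    have hp' := Finset.HasAntidiagonal.mem_antidiagonal.1 hp
    rw [coeff_grad (n := p.2) (N := n) (by omega)]

theorem grad_of_timeDeriv_eq_zero {f : FockZ} (h : ∀ k, timeDeriv k f = 0) : grad f = 0 := by
  ext1 n
  rw [coeff_grad le_rfl, gradTrunc_apply]
  simp [h]

theorem grad_C_X (k : ℕ) : grad (PowerSeries.C (X k)) =
    (Nat.doubleFactorial (2 * k + 1) : FockZ) * PowerSeries.X ^ (2 * k + 2) := by
  ext1 n
  rw [coeff_grad (le_max_left n (k + 1)), gradTrunc_apply, Finset.sum_eq_single k]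
  · rw [timeDeriv_C, pderiv_X_self, map_one, mul_one]
  · intro j _ hj
    rw [timeDeriv_C, pderiv_X_of_ne hj.symm, map_zero, mul_zero]
  · intro h
    simp at h

/-- The coefficients of `grad τ` for `τ` independent of `z`. -/
theorem grad_C (τ : Fock) : grad (PowerSeries.C τ) = PowerSeries.mk fun n =>
    if Even n ∧ n ≠ 0 then (Nat.doubleFactorial (n - 1) : Fock) * pderiv ℂ (n / 2 - 1) τ else 0 := by
  ext1 n
  rw [coeff_grad le_rfl, coeff_gradTrunc, PowerSeries.coeff_mk]
  split_ifs with hn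
  · obtain ⟨⟨j, rfl⟩, h0⟩ := hn
    rw [Finset.sum_eq_single (j - 1)]
    · rw [if_pos (by omega), show j + j - (2 * (j - 1) + 2) = 0 by omega,
        PowerSeries.coeff_zero_C, show 2 * (j - 1) + 1 = j + j - 1 by omega,
        show (j + j) / 2 - 1 = j - 1 by omega]
    · intro k _ hk
      split_ifs with h
      · rw [PowerSeries.coeff_C, if_neg (by omega), map_zero, mul_zero]
      · rfl
    · intro h
      simp at h
      omega
  · refine Finset.sum_eq_zero fun k _ => ?_
    split_ifs with h
    · rw [PowerSeries.coeff_C, if_neg, map_zero, mul_zero]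
      intro h'
      exact hn ⟨⟨k + 1, by omega⟩, by omega⟩
    · rfl

theorem doubleFactorial_two_mul_add_one (k : ℕ) :
    Nat.doubleFactorial (2 * k + 1) = (2 * k + 1) * Nat.doubleFactorial (2 * k - 1) := by
  rcases k with _ | k
  · rfl
  · rw [show 2 * (k + 1) + 1 = (2 * k + 1) + 2 by ring, Nat.doubleFactorial_add_two,
      show 2 * (k + 1) - 1 = 2 * k + 1 by omega]

theorem continuous_coeff_shift (ε : ℂ) (n : ℕ) (d : ℕ →₀ ℕ) :
    @Continuous Fock ℂ (@WithPiTopology.instTopologicalSpace ℕ ℂ ⊥) ⊥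
      fun f => MvPowerSeries.coeff d (PowerSeries.coeff n (shift ε f)) := by
  let : UniformSpace ℂ := ⊥
  have : DiscreteUniformity ℂ := ⟨rfl⟩
  let := WithPiTopology.instTopologicalSpace (σ := ℕ) ℂ
  exact (continuous_coeff_subst (hasSubst_shift ε) (Finsupp.optionElim n d)).congr fun f =>
    (coeff_coeff_optionEquivLeft _ n d).symm

theorem timeDeriv_shift (ε : ℂ) (k : ℕ) (f : Fock) :
    timeDeriv k (shift ε f) = shift ε (pderiv ℂ k f) := by
  let : TopologicalSpace ℂ := ⊥
  have : DiscreteTopology ℂ := ⟨rfl⟩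
  let := WithPiTopology.instTopologicalSpace (σ := ℕ) ℂ
  have hc := continuous_coeff_shift ε
  ext n d
  refine congrFun (eq_of_eq_on_mvPolynomial (R := ℂ)
    (F := fun f => MvPowerSeries.coeff d (PowerSeries.coeff n (timeDeriv k (shift ε f))))
    (G := fun f => MvPowerSeries.coeff d (PowerSeries.coeff n (shift ε (pderiv ℂ k f))))
    ?_ ?_ fun p => ?_) f
  · simp only [coeff_timeDeriv, coeff_pderiv]
    exact (hc _ _).mul continuous_const
  · have : Continuous (pderiv ℂ k : Fock → Fock) := continuous_pi fun d =>
      continuous_coeff_pderiv k d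
    exact (hc n d).comp this
  · refine congrArg (fun g => MvPowerSeries.coeff d (PowerSeries.coeff n g)) ?_
    induction p using MvPolynomial.induction_on with
    | C r =>
      rw [MvPolynomial.coe_C, pderiv_C, ← shiftHom_apply, ← shiftHom_apply, map_zero, shiftHom_C,
        timeDeriv_C, pderiv_C, map_zero]
    | add p q hp hq =>
      simp only [← shiftHom_apply] at hp hq ⊢
      rw [MvPolynomial.coe_add, map_add, map_add, map_add, map_add, hp, hq]
    | mul_X p i hp =>
      simp only [← shiftHom_apply] at hp ⊢
      rw [MvPolynomial.coe_mul, MvPolynomial.coe_X, map_mul, timeDeriv_mul, Derivation.leibniz,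
        map_add, smul_eq_mul, smul_eq_mul, map_mul, map_mul, hp]
      congr 2
      rw [shiftHom_X, map_add, timeDeriv_mul, timeDeriv_C, timeDeriv_C, timeDeriv_X_pow, pderiv_C,
        map_zero, mul_zero, mul_zero, add_zero, add_zero]
      rcases eq_or_ne i k with rfl | hi
      · rw [pderiv_X_self, map_one, map_one]
      · rw [pderiv_X_of_ne hi, map_zero, map_zero]

/-- The chain rule for the dependence of `τ(t + ε [z⁻¹])` on `z`: as `-∂_z = z⁻² ∂_{z⁻¹}` maps
`(2k-1)!! z^(-2k-1)` to `(2k+1)!! z^(-2k-2)`, it acts as `ε ∑_k (2k+1)!! z^(-2k-2) ∂/∂t_k`. -/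
theorem X_sq_mul_derivative_shift (ε : ℂ) (f : Fock) :
    PowerSeries.X ^ 2 * PowerSeries.derivative Fock (shift ε f) =
      PowerSeries.C (MvPowerSeries.C ε) * grad (shift ε f) := by
  let : TopologicalSpace ℂ := ⊥
  have : DiscreteTopology ℂ := ⟨rfl⟩
  let := WithPiTopology.instTopologicalSpace (σ := ℕ) ℂ
  have hc := continuous_coeff_shift ε
  ext n d
  refine congrFun (eq_of_eq_on_mvPolynomial (R := ℂ)
    (F := fun f => MvPowerSeries.coeff d (PowerSeries.coeff n
      (PowerSeries.X ^ 2 * PowerSeries.derivative Fock (shift ε f))))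
    (G := fun f => MvPowerSeries.coeff d (PowerSeries.coeff n
      (PowerSeries.C (MvPowerSeries.C ε) * grad (shift ε f))))
    ?_ ?_ fun p => ?_) f
  · simp only [PowerSeries.coeff_X_pow_mul']
    split_ifs
    · simp only [PowerSeries.coeff_derivative]
      simp_rw [← Nat.cast_succ, mul_comm _ (Nat.cast _ : Fock), ← nsmul_eq_mul, map_nsmul]
      exact (hc _ _).nsmul _
    · exact continuous_const
  · simp only [PowerSeries.coeff_C_mul, MvPowerSeries.coeff_C_mul, coeff_grad le_rfl,
      coeff_gradTrunc, map_sum]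
    refine continuous_const.mul (continuous_finsetSum _ fun k _ => ?_)
    split_ifs
    · simp_rw [← nsmul_eq_mul, map_nsmul, coeff_pderiv]
      exact ((hc _ _).mul continuous_const).nsmul _
    · exact continuous_const
  · refine congrArg (fun g => MvPowerSeries.coeff d (PowerSeries.coeff n g)) ?_
    induction p using MvPolynomial.induction_on with
    | C r =>
      rw [MvPolynomial.coe_C, ← shiftHom_apply, shiftHom_C, PowerSeries.derivative_C,
        grad_of_timeDeriv_eq_zero fun k => by rw [timeDeriv_C, pderiv_C, map_zero], mul_zero,
        mul_zero]
    | add p q hp hq =>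
      simp only [← shiftHom_apply] at hp hq ⊢
      rw [MvPolynomial.coe_add, map_add, map_add, grad_add, mul_add, mul_add, hp, hq]
    | mul_X p i hp =>
      simp only [← shiftHom_apply] at hp ⊢
      rw [MvPolynomial.coe_mul, MvPolynomial.coe_X, map_mul, grad_mul, Derivation.leibniz]
      have h : PowerSeries.X ^ 2 * PowerSeries.derivative Fock (shiftHom ε (X i)) =
          PowerSeries.C (MvPowerSeries.C ε) * grad (shiftHom ε (X i)) := by
        rw [shiftHom_X, grad_add, grad_C_X, grad_of_timeDeriv_eq_zero (f := _ * _) fun k => by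
          rw [timeDeriv_mul, timeDeriv_C, timeDeriv_X_pow, pderiv_C, map_zero, mul_zero, mul_zero,
            add_zero], map_add, Derivation.leibniz, PowerSeries.derivative_C,
          PowerSeries.derivative_C, Derivation.leibniz_pow, PowerSeries.derivative_X,
          doubleFactorial_two_mul_add_one, map_mul, map_mul, map_natCast, map_natCast]
        simp only [smul_eq_mul, nsmul_eq_mul, Nat.add_sub_cancel]
        push_cast
        ring
      rw [smul_eq_mul, smul_eq_mul]
      linear_combination (shiftHom ε (p : Fock)) * h + (shiftHom ε (X i)) * hp

theorem coeff_zero_shift (ε : ℂ) (f : Fock) : PowerSeries.coeff 0 (shift ε f) = f := by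
  let : TopologicalSpace ℂ := ⊥
  have : DiscreteTopology ℂ := ⟨rfl⟩
  let := WithPiTopology.instTopologicalSpace (σ := ℕ) ℂ
  ext d
  refine congrFun (eq_of_eq_on_mvPolynomial (R := ℂ)
    (F := fun f => MvPowerSeries.coeff d (PowerSeries.coeff 0 (shift ε f)))
    (G := fun f => MvPowerSeries.coeff d f)
    (continuous_coeff_shift ε 0 d) (WithPiTopology.continuous_coeff ℂ d) fun p => ?_) f
  refine congrArg (MvPowerSeries.coeff d) ?_
  rw [PowerSeries.coeff_zero_eq_constantCoeff_apply, ← shiftHom_apply]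
  induction p using MvPolynomial.induction_on with
  | C r => rw [MvPolynomial.coe_C, shiftHom_C, PowerSeries.constantCoeff_C]
  | add p q hp hq => rw [MvPolynomial.coe_add, map_add, map_add, hp, hq]
  | mul_X p i hp =>
    rw [MvPolynomial.coe_mul, MvPolynomial.coe_X, map_mul, map_mul, hp, shiftHom_X]
    simp

theorem coeff_one_shift (ε : ℂ) (f : Fock) :
    PowerSeries.coeff 1 (shift ε f) = MvPowerSeries.C ε * pderiv ℂ 0 f := by
  have h := congrArg (PowerSeries.coeff 2) (X_sq_mul_derivative_shift ε f)
  rw [PowerSeries.coeff_X_pow_mul', if_pos le_rfl, PowerSeries.coeff_derivative,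
    PowerSeries.coeff_C_mul, coeff_grad le_rfl, coeff_gradTrunc] at h
  simpa [Finset.sum_range_succ, coeff_zero_shift] using h

end KdV

end

noncomputable section

/-! ### The bilinear identity at `t + [w⁻¹]` and `t - [w⁻¹]` -/

namespace KdV

open MvPowerSeries

variable {σ ι : Type*}

theorem coeff_linearSeries_of_degree_ne_one {A : Type*} [CommRing A] (c : ℕ → A) {d : ℕ →₀ ℕ}
    (hd : d.degree ≠ 1) : MvPowerSeries.coeff d (linearSeries c) = 0 :=
  if_neg hd

theorem coeff_subst_linearSeries {A : Type*} [CommRing A] {a : ℕ → MvPowerSeries ι A}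
    (ha : HasSubst a) (c : ℕ → A) (m : ι →₀ ℕ) :
    MvPowerSeries.coeff m (subst a (linearSeries c)) =
      ∑ᶠ j, c j * MvPowerSeries.coeff m (a j) := by
  rw [coeff_subst ha]
  have hinj : Function.Injective fun j : ℕ => Finsupp.single j 1 :=
    Finsupp.single_left_injective one_ne_zero
  set F : (ℕ →₀ ℕ) → A := fun d => MvPowerSeries.coeff d (linearSeries c) •
    MvPowerSeries.coeff m (d.prod fun s e => a s ^ e) with hF
  have h := finsum_mem_range (f := F) hinj
  rw [finsum_mem_def, Set.indicator_eq_self.2] at h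
  · rw [h]
    refine finsum_congr fun j => ?_
    simp only [hF]
    rw [coeff_single_linearSeries, Finsupp.prod_single_index (by simp), pow_one, smul_eq_mul]
  · intro d hd
    have h1 : d.degree = 1 := by
      by_contra hne
      apply hd
      simp only [hF]
      rw [coeff_linearSeries_of_degree_ne_one c hne, zero_smul]
    obtain ⟨j, hj⟩ : ∃ j, d j ≠ 0 := by
      by_contra! hc
      rw [Finsupp.ext (g := 0) hc] at h1
      simp at h1
    have hle : Finsupp.single j 1 ≤ d := by
      rw [Finsupp.single_le_iff]
      omega
    have h2 := congrArg Finsupp.degree (add_tsub_cancel_of_le hle)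
    rw [map_add, Finsupp.degree_single, h1] at h2
    have h3 : d - Finsupp.single j 1 = 0 := (Finsupp.degree_eq_zero_iff _).1 (by omega)
    exact ⟨j, by simpa [h3] using add_tsub_cancel_of_le hle⟩

theorem constantCoeff_powerSeries_subst {A : Type*} [CommRing A] {a : MvPowerSeries σ A}
    (ha : MvPowerSeries.constantCoeff a = 0) (f : PowerSeries A) :
    MvPowerSeries.constantCoeff (f.subst a) = PowerSeries.constantCoeff f := by
  have hs : PowerSeries.HasSubst a := PowerSeries.HasSubst.of_constantCoeff_zero ha
  have h := PowerSeries.constantCoeff_subst_eq_zero ha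
    (f - PowerSeries.C (PowerSeries.constantCoeff f)) (by simp)
  rw [PowerSeries.subst_sub hs, PowerSeries.subst_C, map_sub, MvPowerSeries.constantCoeff_C] at h
  exact sub_eq_zero.1 h

/-- The series `2 artanh u = ∑ 2 u^(2j+1) / (2j+1)`. -/
def twoArtanh : PowerSeries LaurentZ :=
  PowerSeries.mk fun n => if Odd n then HahnSeries.C (2 / (n : ℂ)) else 0

theorem constantCoeff_twoArtanh : PowerSeries.constantCoeff twoArtanh = 0 := by
  rw [← PowerSeries.coeff_zero_eq_constantCoeff_apply, twoArtanh, PowerSeries.coeff_mk, if_neg]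
  simp

/-- The solution of `e' = (2 artanh u)' e` with `e(0) = 1` is `(1 + u) / (1 - u)`. -/
theorem one_sub_X_mul_eq_of_derivative_eq {e : PowerSeries LaurentZ}
    (hd : PowerSeries.derivative LaurentZ e = e * PowerSeries.derivative LaurentZ twoArtanh)
    (he : PowerSeries.constantCoeff e = 1) :
    (1 - PowerSeries.X) * e = 1 + PowerSeries.X := by
  have : CharZero LaurentZ := algebraRat.charZero _
  have ha : (1 - PowerSeries.X ^ 2) * PowerSeries.derivative LaurentZ twoArtanh = 2 := by
    have hc : ∀ n, PowerSeries.coeff n (PowerSeries.derivative LaurentZ twoArtanh) =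
        if Even n then 2 else 0 := by
      intro n
      rw [PowerSeries.coeff_derivative, twoArtanh, PowerSeries.coeff_mk]
      by_cases hn : Even n
      · rw [if_pos hn, if_pos hn.add_one, ← Nat.cast_succ, ← map_natCast (HahnSeries.C (Γ := ℤ)),
          ← map_mul, div_mul_cancel₀ _ (Nat.cast_ne_zero.2 (Nat.succ_ne_zero n)), map_ofNat]
      · rw [if_neg hn, if_neg (by simpa [Nat.odd_add_one] using hn), zero_mul]
    ext1 n
    rw [sub_mul, one_mul, map_sub, PowerSeries.coeff_X_pow_mul', hc,
      ← map_ofNat (PowerSeries.C (R := LaurentZ)) 2, PowerSeries.coeff_C]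
    rcases n with _ | _ | n
    · simp
    · simp
    · simp [hc, Nat.even_add_one]
  set f : PowerSeries LaurentZ := (1 - PowerSeries.X) * e with hf
  have hf' : (1 + PowerSeries.X) * PowerSeries.derivative LaurentZ f = f := by
    rw [hf, Derivation.leibniz, hd, map_sub, PowerSeries.derivative_X, PowerSeries.derivative_one,
      smul_eq_mul, smul_eq_mul]
    linear_combination e * ha
  have h0 : PowerSeries.coeff 0 f = 1 := by
    rw [PowerSeries.coeff_zero_eq_constantCoeff_apply, hf, map_mul, he]
    simp
  have hrec : ∀ n, PowerSeries.coeff (n + 1) f * (n + 1) +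
      (PowerSeries.coeff n f * n) = PowerSeries.coeff n f := by
    intro n
    conv_rhs => rw [← hf']
    rw [add_mul, one_mul, map_add, PowerSeries.coeff_derivative]
    congr 1
    rcases n with _ | n
    · simp
    · rw [PowerSeries.coeff_succ_X_mul, PowerSeries.coeff_derivative]
      push_cast
      rfl
  have h1 : PowerSeries.coeff 1 f = 1 := by
    have := hrec 0
    simpa [h0] using this
  have h2 : ∀ n, PowerSeries.coeff (n + 2) f = 0 := by
    intro n
    induction n with
    | zero =>
      have := hrec 1
      rw [h1] at this
      have h3 : PowerSeries.coeff 2 f * (1 + 1) = 0 := by simpa using this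
      refine (mul_eq_zero.1 h3).resolve_right ?_
      exact_mod_cast two_ne_zero (α := LaurentZ)
    | succ n ih =>
      have := hrec (n + 2)
      rw [ih] at this
      rw [zero_mul, add_zero] at this
      refine (mul_eq_zero.1 this).resolve_right ?_
      rw [← Nat.cast_succ]
      exact Nat.cast_ne_zero.2 (Nat.succ_ne_zero _)
  ext1 n
  rcases n with _ | _ | n
  · rw [h0]; simp
  · rw [h1]; simp [PowerSeries.coeff_one]
  · rw [h2, map_add, PowerSeries.coeff_one, PowerSeries.coeff_X]
    simp

theorem one_sub_X_mul_exp_twoArtanh :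
    (1 - PowerSeries.X) * ((PowerSeries.exp LaurentZ).subst twoArtanh : PowerSeries LaurentZ) =
      1 + PowerSeries.X := by
  have hs : PowerSeries.HasSubst twoArtanh :=
    PowerSeries.HasSubst.of_constantCoeff_zero' constantCoeff_twoArtanh
  refine one_sub_X_mul_eq_of_derivative_eq ?_ ?_
  · rw [PowerSeries.derivative_subst hs, PowerSeries.derivative_exp]
  · exact (constantCoeff_powerSeries_subst constantCoeff_twoArtanh _).trans
      PowerSeries.constantCoeff_exp

/-- The substitution `t ↦ t + [w⁻¹]`, `t̃ ↦ t - [w⁻¹]`; the variable `X none` is `w⁻¹`. -/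
def hirotaSubst : ℕ ⊕ ℕ → MvPowerSeries (Option ℕ) ℂ :=
  Sum.elim (shiftSubst 1) (shiftSubst (-1))

theorem hasSubst_hirotaSubst : HasSubst hirotaSubst where
  const_coeff i := by
    rcases i with i | i
    · exact (hasSubst_shiftSubst 1).const_coeff i
    · exact (hasSubst_shiftSubst (-1)).const_coeff i
  coeff_zero d := by
    refine ((((hasSubst_shiftSubst 1).coeff_zero d).image Sum.inl).union
      (((hasSubst_shiftSubst (-1)).coeff_zero d).image Sum.inr)).subset ?_
    rintro (i | i) hi
    · exact Or.inl ⟨i, hi, rfl⟩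
    · exact Or.inr ⟨i, hi, rfl⟩

/-- The coefficients of `a` regarded as constant Laurent series. -/
def liftSubst (a : σ → MvPowerSeries ι ℂ) : σ → MvPowerSeries ι LaurentZ :=
  fun i => MvPowerSeries.map HahnSeries.C (a i)

theorem hasSubst_liftSubst {a : σ → MvPowerSeries ι ℂ} (ha : HasSubst a) :
    HasSubst (liftSubst a) := ha.map _

theorem subst_rename_embedding {κ A : Type*} [CommRing A] {a : σ → MvPowerSeries ι A}
    (ha : HasSubst a) (e : κ ↪ σ) (f : MvPowerSeries κ A) :
    subst a (rename e f) = subst (fun i => a (e i)) f := by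
  rw [rename_eq_subst, subst_comp_subst_apply (HasSubst.X_comp _) ha]
  congr 1
  funext i
  exact subst_X ha _

theorem subst_expSeries {a : σ → MvPowerSeries ι LaurentZ} (ha : HasSubst a)
    {f : MvPowerSeries σ LaurentZ} (hf : MvPowerSeries.constantCoeff f = 0) :
    subst a (expSeries f) = expSeries (subst a f) := by
  have hf' : PowerSeries.HasSubst f := PowerSeries.HasSubst.of_constantCoeff_zero hf
  rw [expSeries, PowerSeries.subst_def, subst_comp_subst_apply hf'.const ha]
  rfl

theorem constantCoeff_theta : MvPowerSeries.constantCoeff theta = 0 := by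
  rw [← MvPowerSeries.coeff_zero_eq_constantCoeff_apply]
  have h : (0 : ℕ →₀ ℕ).degree ≠ 1 := by simp
  exact coeff_linearSeries_of_degree_ne_one _ h

/-- `ϑ(z; 2[w⁻¹]) = 2 artanh (z/w)`. -/
theorem subst_theta_sub_subst_theta :
    subst (liftSubst (shiftSubst 1)) theta - subst (liftSubst (shiftSubst (-1))) theta =
      twoArtanh.subst (MvPowerSeries.C zL * X none : MvPowerSeries (Option ℕ) LaurentZ) := by
  have hp := hasSubst_liftSubst (hasSubst_shiftSubst 1)
  have hm := hasSubst_liftSubst (hasSubst_shiftSubst (-1))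
  have hzv : PowerSeries.HasSubst
      (MvPowerSeries.C zL * X none : MvPowerSeries (Option ℕ) LaurentZ) :=
    PowerSeries.HasSubst.of_constantCoeff_zero (by simp)
  classical
  ext1 m
  rw [map_sub, theta, coeff_subst_linearSeries hp, coeff_subst_linearSeries hm,
    ← finsum_sub_distrib, PowerSeries.coeff_subst hzv]
  rotate_left
  · exact (hp.coeff_zero m).subset fun j hj h => hj (by simp [h])
  · exact (hm.coeff_zero m).subset fun j hj h => hj (by simp [h])
  have hl : ∀ j : ℕ, HahnSeries.single (-(2 * (j : ℤ) + 1))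
        ((Nat.doubleFactorial (2 * j + 1) : ℂ)⁻¹) *
          MvPowerSeries.coeff m (liftSubst (shiftSubst 1) j) -
        HahnSeries.single (-(2 * (j : ℤ) + 1)) ((Nat.doubleFactorial (2 * j + 1) : ℂ)⁻¹) *
          MvPowerSeries.coeff m (liftSubst (shiftSubst (-1)) j) =
      if m = Finsupp.single none (2 * j + 1) then
        HahnSeries.single (-(2 * (j : ℤ) + 1)) (2 / ((2 * j + 1 : ℕ) : ℂ)) else 0 := by
    intro j
    rw [← mul_sub, ← map_sub, liftSubst, liftSubst, ← map_sub, shiftSubst, shiftSubst,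
      add_sub_add_left_eq_sub, ← sub_smul, MvPowerSeries.coeff_map, map_smul,
      MvPowerSeries.coeff_X_pow]
    split_ifs
    · rw [smul_eq_mul, mul_one, HahnSeries.C_apply, HahnSeries.single_mul_single, add_zero]
      congr 1
      rw [doubleFactorial_two_mul_add_one]
      have : (Nat.doubleFactorial (2 * j - 1) : ℂ) ≠ 0 := by
        exact_mod_cast (Nat.doubleFactorial_pos _).ne'
      have h' : ((2 * j + 1 : ℕ) : ℂ) ≠ 0 := by exact_mod_cast Nat.succ_ne_zero (2 * j)
      push_cast at h' ⊢
      field_simp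
      ring
    · simp
  have hr : ∀ n : ℕ, PowerSeries.coeff n twoArtanh • MvPowerSeries.coeff m
        ((MvPowerSeries.C zL * X none : MvPowerSeries (Option ℕ) LaurentZ) ^ n) =
      if m = Finsupp.single none n then
        if Odd n then HahnSeries.single (-(n : ℤ)) (2 / (n : ℂ)) else 0 else 0 := by
    intro n
    rw [mul_pow, ← map_pow, MvPowerSeries.coeff_C_mul, MvPowerSeries.coeff_X_pow, twoArtanh,
      PowerSeries.coeff_mk]
    split_ifs
    · rw [mul_one, smul_eq_mul, HahnSeries.C_apply, zL, HahnSeries.single_pow,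
        HahnSeries.single_mul_single, zero_add]
      simp
    · simp
    · simp
    · simp
  rw [finsum_congr hl, finsum_congr hr]
  by_cases hm : ∃ j, m = Finsupp.single none (2 * j + 1)
  · obtain ⟨j, rfl⟩ := hm
    rw [finsum_eq_single _ j, finsum_eq_single _ (2 * j + 1), if_pos rfl, if_pos rfl,
      if_pos ⟨j, rfl⟩]
    · push_cast
      rfl
    · intro n hn
      rw [if_neg]
      intro h
      exact hn (Finsupp.single_injective _ h).symm
    · intro n hn
      rw [if_neg]
      intro h
      have := Finsupp.single_injective _ h
      omega
  · push Not at hm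
    have h1 : ∀ n : ℕ, (if m = Finsupp.single none n then
        if Odd n then HahnSeries.single (-(n : ℤ)) (2 / (n : ℂ)) else 0 else 0 : LaurentZ) = 0 := by
      intro n
      split_ifs with h2 h3
      · obtain ⟨j, rfl⟩ := h3
        exact absurd h2 (hm j)
      · rfl
      · rfl
    simp only [h1, if_neg (hm _), finsum_zero]

/-- The exponential factor of the bilinear identity becomes `(1 + z/w) / (1 - z/w)`. -/
theorem one_sub_mul_subst_expSeries :
    (1 - MvPowerSeries.C zL * X none) * subst (liftSubst hirotaSubst)
      (expSeries (rename (Function.Embedding.inl : ℕ ↪ ℕ ⊕ ℕ) theta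
        - rename (Function.Embedding.inr : ℕ ↪ ℕ ⊕ ℕ) theta)) =
      1 + MvPowerSeries.C zL * X none := by
  have hs := hasSubst_liftSubst hasSubst_hirotaSubst
  have hzv : PowerSeries.HasSubst
      (MvPowerSeries.C zL * X none : MvPowerSeries (Option ℕ) LaurentZ) :=
    PowerSeries.HasSubst.of_constantCoeff_zero (by simp)
  rw [subst_expSeries hs (by simp [constantCoeff_theta]), ← substAlgHom_apply hs, map_sub,
    substAlgHom_apply, substAlgHom_apply, subst_rename_embedding hs, subst_rename_embedding hs]
  have h1 : (fun i => liftSubst hirotaSubst ((Function.Embedding.inl : ℕ ↪ ℕ ⊕ ℕ) i)) =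
    liftSubst (shiftSubst 1) := rfl
  have h2 : (fun i => liftSubst hirotaSubst ((Function.Embedding.inr : ℕ ↪ ℕ ⊕ ℕ) i)) =
    liftSubst (shiftSubst (-1)) := rfl
  rw [h1, h2, subst_theta_sub_subst_theta, expSeries]
  have h := congrArg (PowerSeries.substAlgHom (R := LaurentZ) hzv) one_sub_X_mul_exp_twoArtanh
  rw [map_mul, map_sub, map_add, map_one, PowerSeries.substAlgHom_X, PowerSeries.coe_substAlgHom,
    PowerSeries.subst_comp_subst_apply (PowerSeries.HasSubst.of_constantCoeff_zero'
      constantCoeff_twoArtanh) hzv] at h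
  exact h

end KdV

end

noncomputable section

namespace KdV

open MvPowerSeries

variable {σ ι : Type*}

/-- `(1 + zv) / (1 - zv)`, expanded in powers of `v`, has no negative powers of `z`. -/
theorem slice_eq_zero_of_one_sub_mul_eq {i : σ} {E : MvPowerSeries σ LaurentZ}
    (hE : (1 - MvPowerSeries.C zL * X i) * E = 1 + MvPowerSeries.C zL * X i) {n : ℤ}
    (hn : 0 < n) : slice n E = 0 := by
  have hX : ∀ (n : ℤ) (f : MvPowerSeries σ LaurentZ),
      slice n (MvPowerSeries.C zL * X i * f) = X i * slice (n + 1) f := by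
    intro n f
    have h := slice_C_single_mul (n + 1) (-1) (X i * f)
    rw [add_neg_cancel_right] at h
    rw [mul_assoc, zL, h, ← slice_mul_map_C, MvPowerSeries.map_X]
  have h1 : ∀ n : ℤ, 0 < n → slice n (1 : MvPowerSeries σ LaurentZ) = 0 := by
    intro n hn
    classical
    ext m
    rw [coeff_slice, MvPowerSeries.coeff_one]
    split_ifs
    · rw [HahnSeries.coeff_one, if_neg hn.ne', map_zero]
    · rw [map_zero, HahnSeries.coeff_zero]
  have hstep : ∀ n : ℤ, 0 < n → slice n E = X i * slice (n + 1) E := by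
    intro n hn
    have h := congrArg (slice n) hE
    have h2 := hX n 1
    rw [mul_one, h1 _ (by omega), mul_zero] at h2
    rw [sub_mul, one_mul, map_sub, hX, map_add, h1 n hn, h2, add_zero, sub_eq_zero] at h
    exact h
  have hdvd : ∀ (k : ℕ) (n : ℤ), 0 < n → X i ^ k ∣ slice n E := by
    intro k
    induction k with
    | zero => intro n _; simp
    | succ k ih =>
      intro n hn
      rw [hstep n hn, pow_succ']
      exact mul_dvd_mul_left _ (ih _ (by omega))
  ext m
  exact X_pow_dvd_iff.1 (hdvd (m i + 1) n hn) m (Nat.lt_succ_self _)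

/-- The residue of `g(z) (1 + zv) / (1 - zv)`, for a power series `g` in `z⁻¹`.  In the
decomposition `g = g(v) + (z⁻¹ - v) q` the first term does not contribute, and the second one
gives `(z⁻¹ + v) q`. -/
theorem slice_one_embedSeries_mul {i : σ} {E : MvPowerSeries σ LaurentZ}
    (hE : (1 - MvPowerSeries.C zL * X i) * E = 1 + MvPowerSeries.C zL * X i)
    (g : PowerSeries (MvPowerSeries σ ℂ)) (hg : slice 1 (embedSeries σ g * E) = 0) :
    2 * evalDiagonal i g = 2 * PowerSeries.coeff 0 g + X i * PowerSeries.coeff 1 g := by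
  obtain ⟨q, hq⟩ := exists_eq_C_evalDiagonal_add i g
  have hz : embedSeries σ PowerSeries.X * (MvPowerSeries.C zL) = 1 := by
    rw [embedSeries_X, ← map_mul, zL, HahnSeries.single_mul_single]
    simp
  have hv : embedSeries σ (PowerSeries.C (X i)) = X i := by
    rw [embedSeries_C, MvPowerSeries.map_X]
  have hE' : embedSeries σ (PowerSeries.X - PowerSeries.C (X i)) * E =
      embedSeries σ (PowerSeries.X + PowerSeries.C (X i)) := by
    rw [map_sub, map_add, hv]
    linear_combination (embedSeries σ PowerSeries.X) * hE + (X i * E + X i) * hz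
  have hprod : embedSeries σ g * E = MvPowerSeries.map HahnSeries.C (evalDiagonal i g) * E
      + embedSeries σ ((PowerSeries.X + PowerSeries.C (X i)) * q) := by
    conv_lhs => rw [hq]
    rw [map_add, embedSeries_C, map_mul, map_mul, ← hE']
    ring
  rw [hprod, map_add, slice_mul_map_C, slice_eq_zero_of_one_sub_mul_eq hE one_pos, mul_zero,
    zero_add, slice_embedSeries, if_neg (by norm_num)] at hg
  have hX1 : ∀ f : PowerSeries (MvPowerSeries σ ℂ),
      PowerSeries.coeff 1 (PowerSeries.X * f) = PowerSeries.coeff 0 f := fun f =>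
    PowerSeries.coeff_succ_X_mul 0 f
  have h0 := congrArg (PowerSeries.coeff 0) hq
  have h1 := congrArg (PowerSeries.coeff 1) hq
  rw [sub_mul, map_add, map_sub, PowerSeries.coeff_zero_C, PowerSeries.coeff_zero_X_mul,
    PowerSeries.coeff_C_mul] at h0
  rw [sub_mul, map_add, map_sub, PowerSeries.coeff_C, if_neg one_ne_zero,
    hX1, PowerSeries.coeff_C_mul] at h1
  rw [Int.natAbs_one, add_mul, map_add, hX1, PowerSeries.coeff_C_mul] at hg
  linear_combination (-2) * h0 - X i * h1 + X i * hg

theorem evalDiagonal_map_shift (ε : ℂ) (τ : Fock) :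
    evalDiagonal none (PowerSeries.map (substAlgHom (R := ℂ) (hasSubst_shiftSubst ε) :
      Fock →+* MvPowerSeries (Option ℕ) ℂ) (shift (-ε) τ)) =
      rename (Function.Embedding.some : ℕ ↪ Option ℕ) τ := by
  have ha := hasSubst_optionSubst (hasSubst_shiftSubst ε)
  have hd := hasSubst_diagonalSubst (R := ℂ) (none : Option ℕ)
  rw [shift, map_subst_optionEquivLeft, evalDiagonal_optionEquivLeft,
    subst_comp_subst_apply (hasSubst_shift _) ha, subst_comp_subst_apply _ hd, rename_eq_subst]
  swap
  · simpa only [coe_substAlgHom] using (hasSubst_shift (-ε)).comp ha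
  congr 1
  funext k
  rw [← substAlgHom_apply ha, ← substAlgHom_apply hd, map_add, map_smul, map_pow, substAlgHom_X,
    substAlgHom_X, map_add, map_smul, map_pow]
  simp only [optionSubst]
  rw [substAlgHom_apply hd, substAlgHom_apply hd, subst_rename_some hd, subst_X hd]
  have : (fun j : Option ℕ => diagonalSubst ℂ (none : Option ℕ) (some j)) = X := rfl
  rw [this, subst_self, diagonalSubst, shiftSubst]
  simp

/-- The Wronskian identity `τ(t-[z⁻¹])_x τ(t+[z⁻¹]) - τ(t-[z⁻¹]) τ(t+[z⁻¹])_x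
+ 2z τ(t-[z⁻¹]) τ(t+[z⁻¹]) = 2z τ²`, multiplied by `z⁻¹`. -/
theorem wronskian_identity {τ : Fock} (hτ : IsTauFunction τ) :
    2 * PowerSeries.C τ ^ 2 = 2 * (shift (-1) τ * shift 1 τ) +
      PowerSeries.X * (shift 1 τ * shift (-1) (pderiv ℂ 0 τ)
        - shift (-1) τ * shift 1 (pderiv ℂ 0 τ)) := by
  have hs := hasSubst_liftSubst hasSubst_hirotaSubst
  have hslice : slice 1 (hirotaProduct τ) = 0 := by
    ext m
    have h := hτ.hirota 0 m
    rw [mul_zero, pow_zero, mul_one, resInfty, neg_eq_zero] at h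
    exact h
  have h0 : slice 1 (subst (liftSubst hirotaSubst) (hirotaProduct τ)) = 0 := by
    refine (slice_subst hasSubst_hirotaSubst 1 _).trans ?_
    rw [hslice, ← substAlgHom_apply hasSubst_hirotaSubst, map_zero]
  set P := PowerSeries.map (substAlgHom (R := ℂ) (hasSubst_shiftSubst 1) :
    Fock →+* MvPowerSeries (Option ℕ) ℂ) (shift (-1) τ) with hP
  set M := PowerSeries.map (substAlgHom (R := ℂ) (hasSubst_shiftSubst (-1)) :
    Fock →+* MvPowerSeries (Option ℕ) ℂ) (shift 1 τ) with hM
  rw [hirotaProduct, subst_mul hs, subst_mul hs, subst_rename_embedding hs,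
    subst_rename_embedding hs, embed_eq_embedSeries] at h0
  have h1 := subst_embedSeries (hasSubst_shiftSubst 1) (shift (-1) τ)
  have h2 := subst_embedSeries (hasSubst_shiftSubst (-1)) (shift 1 τ)
  have h3 := slice_one_embedSeries_mul one_sub_mul_subst_expSeries (P * M) (by
    rw [(embedSeries (Option ℕ)).map_mul, hP, hM, ← h1, ← h2]
    exact h0)
  have hP1 : evalDiagonal none P = _ := evalDiagonal_map_shift 1 τ
  have hM1 : evalDiagonal none M =
      rename (Function.Embedding.some : ℕ ↪ Option ℕ) τ := by
    have h := evalDiagonal_map_shift (-1) τ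
    rwa [neg_neg] at h
  rw [map_mul, hP1, hM1, PowerSeries.coeff_zero_eq_constantCoeff_apply, map_mul,
    PowerSeries.coeff_one_mul, ← PowerSeries.coeff_zero_eq_constantCoeff_apply,
    ← PowerSeries.coeff_zero_eq_constantCoeff_apply, hP, hM] at h3
  simp only [PowerSeries.coeff_map, coeff_zero_shift, coeff_one_shift, RingHom.coe_coe] at h3
  have h4 := congrArg (optionEquivLeft ℕ ℂ) h3
  have hT : ∀ ε f, optionEquivLeft ℕ ℂ (substAlgHom (R := ℂ) (hasSubst_shiftSubst ε) f) =
      shift ε f := fun ε f => shiftHom_apply ε f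
  simp only [map_mul, map_add, map_neg, map_one, map_ofNat, optionEquivLeft_rename_some, hT,
    optionEquivLeft_X_none] at h4
  linear_combination h4

end KdV

end

noncomputable section

/-! ### The derivations `∂ₓ` and `∂_z` on the wave ring -/

namespace KdV

open MvPowerSeries

variable {σ : Type*}

theorem slice_pderiv (n : ℤ) (i : σ) (f : MvPowerSeries σ LaurentZ) :
    slice n (pderiv LaurentZ i f) = pderiv ℂ i (slice n f) := by
  ext m
  rw [coeff_slice, coeff_pderiv, coeff_pderiv, coeff_slice, ← Nat.cast_succ, ← Nat.cast_succ,
    mul_comm, mul_comm (HahnSeries.coeff _ _), ← nsmul_eq_mul, ← nsmul_eq_mul,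
    HahnSeries.coeff_nsmul]
  rfl

theorem dxRing_embed (f : FockZ) : dxRing (embed f) = embed (timeDeriv 0 f) := by
  refine ext_slice fun n => ?_
  rw [dxRing, slice_pderiv, embed_eq_embedSeries, slice_embedSeries, slice_embedSeries]
  split_ifs
  · rw [map_zero]
  · rw [coeff_timeDeriv]

theorem slice_dzRing (n : ℤ) (f : WaveRing) :
    slice (n + 1) (dzRing f) = MvPowerSeries.C (-(n : ℂ)) * slice n f := by
  ext m
  rw [coeff_slice, coeff_dzRing, coeff_dzLaurent, MvPowerSeries.coeff_C_mul, coeff_slice]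

theorem dzRing_embed (f : FockZ) :
    dzRing (embed f) = -embed (PowerSeries.X ^ 2 * PowerSeries.derivative Fock f) := by
  refine ext_slice fun n => ?_
  obtain ⟨n, rfl⟩ : ∃ k, n = k + 1 := ⟨n - 1, by ring⟩
  rw [slice_dzRing, map_neg (slice (n + 1)), embed_eq_embedSeries, slice_embedSeries,
    slice_embedSeries, map_neg]
  rcases lt_or_ge n 0 with hn | hn
  · rw [if_pos hn, mul_zero]
    split_ifs with h
    · rw [neg_zero]
    · rw [show n + 1 = 0 by omega]
      simp
  · rw [if_neg (by omega), if_neg (by omega)]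
    obtain ⟨k, rfl⟩ := Int.eq_ofNat_of_zero_le hn
    rw [show ((k : ℤ) + 1).natAbs = k + 1 by omega, PowerSeries.coeff_X_pow_mul',
      Int.natAbs_natCast]
    rcases k with _ | k
    · simp
    · rw [if_pos (by omega), show k + 1 + 1 - 2 = k by omega, PowerSeries.coeff_derivative]
      have h : (MvPowerSeries.C (((k + 1 : ℕ) : ℤ) : ℂ) : Fock) = (k : Fock) + 1 := by
        rw [Int.cast_natCast, map_natCast, Nat.cast_succ]
      rw [h]
      ring

theorem dzRing_embed_shift (ε : ℂ) (f : Fock) :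
    dzRing (embed (shift ε f)) =
      -embed (PowerSeries.C (MvPowerSeries.C ε) * grad (shift ε f)) := by
  rw [dzRing_embed, X_sq_mul_derivative_shift]

theorem dzRing_embed_C (f : Fock) : dzRing (embed (PowerSeries.C f)) = 0 := by
  rw [dzRing_embed, PowerSeries.derivative_C, mul_zero, map_zero, neg_zero]

/-- `∂_z` as an additive map. -/
def dzHom : WaveRing →+ WaveRing := AddMonoidHom.mk' dzRing dzRing_add

theorem dzRing_neg (f : WaveRing) : dzRing (-f) = -dzRing f := map_neg dzHom f

theorem dzRing_sub (f g : WaveRing) : dzRing (f - g) = dzRing f - dzRing g := map_sub dzHom f g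

theorem dzRing_one : dzRing 1 = 0 := by
  have h := dzRing_mul 1 1
  simpa using h

theorem dxRing_mul (f g : WaveRing) : dxRing (f * g) = f * dxRing g + g * dxRing f := by
  rw [dxRing, Derivation.leibniz, smul_eq_mul, smul_eq_mul]
  rfl

theorem dzRing_C_zL : dzRing (MvPowerSeries.C zL) = 1 := by
  ext m n
  obtain ⟨n, rfl⟩ : ∃ k, n = k + 1 := ⟨n - 1, by ring⟩
  classical
  rw [coeff_dzRing, coeff_dzLaurent, MvPowerSeries.coeff_C, MvPowerSeries.coeff_one]
  split_ifs
  · rw [zL, HahnSeries.coeff_single, HahnSeries.coeff_one]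
    split_ifs with h1 h2 h2
    · simp [h1]
    · omega
    · omega
    · simp
  · simp

theorem dxRing_theta : dxRing theta = MvPowerSeries.C zL := by
  classical
  ext1 m
  rw [dxRing, coeff_pderiv, MvPowerSeries.coeff_C]
  split_ifs with hm
  · rw [hm, zero_add, theta, coeff_single_linearSeries]
    simp [zL]
  · rw [theta, coeff_linearSeries_of_degree_ne_one, zero_mul]
    rw [map_add, Finsupp.degree_single]
    have : m.degree ≠ 0 := fun h => hm ((Finsupp.degree_eq_zero_iff m).1 h)
    omega

/-- The chain rule `D (exp f) = D f exp f`, for an additive map `D` with the Leibniz rule that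
lowers degrees in `t` by at most one. -/
theorem derivation_expSeries (D : MvPowerSeries σ LaurentZ →+ MvPowerSeries σ LaurentZ)
    (hD : ∀ f g, D (f * g) = f * D g + g * D f)
    (hloc : ∀ f m, (∀ m' : σ →₀ ℕ, m'.degree ≤ m.degree + 1 → MvPowerSeries.coeff m' f = 0) →
      MvPowerSeries.coeff m (D f) = 0)
    {f : MvPowerSeries σ LaurentZ} (hf : MvPowerSeries.constantCoeff f = 0) :
    D (expSeries f) = D f * expSeries f := by
  have hs : PowerSeries.HasSubst f := PowerSeries.HasSubst.of_constantCoeff_zero hf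
  set c : ℕ → MvPowerSeries σ LaurentZ := fun n =>
    MvPowerSeries.C (PowerSeries.coeff n (PowerSeries.exp LaurentZ)) with hc
  have hc1 : ∀ n, c n * (Nat.factorial n : MvPowerSeries σ LaurentZ) = 1 := by
    intro n
    simp only [hc]
    rw [PowerSeries.coeff_exp, ← map_natCast (MvPowerSeries.C (σ := σ) (R := LaurentZ)),
      ← map_natCast (algebraMap ℚ LaurentZ), ← map_mul, ← map_mul, one_div,
      inv_mul_cancel₀ (by exact_mod_cast Nat.factorial_ne_zero n), map_one, map_one]
  have hcs : ∀ n, c (n + 1) * ((n : MvPowerSeries σ LaurentZ) + 1) = c n := by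
    intro n
    have h1 := hc1 (n + 1)
    rw [Nat.factorial_succ] at h1
    push_cast at h1
    linear_combination (c n) * h1 - c (n + 1) * (n + 1) * hc1 n
  have hD1 : D 1 = 0 := by
    have h := hD 1 1
    simpa using h
  have hDc : ∀ n, D (c n) = 0 := by
    intro n
    have h := congrArg D (hc1 n)
    have h2 : D (Nat.factorial n : MvPowerSeries σ LaurentZ) = 0 := by
      rw [← nsmul_one, map_nsmul, hD1, nsmul_eq_mul, mul_zero]
    rw [hD, h2, hD1, mul_zero, zero_add] at h
    linear_combination (c n) * h - D (c n) * hc1 n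
  set p : ℕ → MvPowerSeries σ LaurentZ := fun N => ∑ n ∈ Finset.range N, c n * f ^ n with hp
  have hpow : ∀ n (m : σ →₀ ℕ), m.degree < n → MvPowerSeries.coeff m (f ^ n) = 0 := by
    intro n m hm
    refine MvPowerSeries.coeff_of_lt_order ?_
    refine lt_of_lt_of_le ?_ (MvPowerSeries.le_order_pow n)
    have h1 : 1 ≤ f.order := MvPowerSeries.one_le_order_iff_constCoeff_eq_zero.2 hf
    calc ((m.degree : ℕ) : ℕ∞) < n := by exact_mod_cast hm
      _ = n • (1 : ℕ∞) := by simp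
      _ ≤ n • f.order := by gcongr
  have happ : ∀ N (m : σ →₀ ℕ), m.degree < N →
      MvPowerSeries.coeff m (expSeries f) = MvPowerSeries.coeff m (p N) := by
    intro N m hm
    rw [expSeries, PowerSeries.coeff_subst hs, finsum_eq_sum_of_support_subset
      (s := Finset.range N)]
    · rw [hp, map_sum]
      refine Finset.sum_congr rfl fun n _ => ?_
      rw [hc, MvPowerSeries.coeff_C_mul, smul_eq_mul]
    · intro n hn
      by_contra hN
      rw [Finset.coe_range, Set.mem_Iio, not_lt] at hN
      refine hn ?_
      change _ • MvPowerSeries.coeff m (f ^ n) = 0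
      rw [hpow n m (by omega), smul_eq_mul, mul_zero]
  have hDpow : ∀ n, D (f ^ n) = n • (f ^ (n - 1) * D f) := by
    intro n
    induction n with
    | zero => simpa using hD1
    | succ n ih =>
      rw [pow_succ, hD, ih]
      rcases n with _ | n
      · simp
      · simp only [Nat.add_sub_cancel, nsmul_eq_mul, Nat.cast_add, Nat.cast_one]
        ring
  have hDp : ∀ N, D (p (N + 1)) = D f * p N := by
    intro N
    simp only [hp]
    rw [Finset.sum_range_succ', map_add, map_sum, Finset.mul_sum, pow_zero, mul_one, hDc, add_zero]
    refine Finset.sum_congr rfl fun n _ => ?_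
    rw [hD, hDc, mul_zero, add_zero, hDpow, Nat.add_sub_cancel, nsmul_eq_mul, ← hcs n]
    push_cast
    ring
  ext1 m
  have h1 : MvPowerSeries.coeff m (D (expSeries f)) =
      MvPowerSeries.coeff m (D (p (m.degree + 2))) := by
    rw [← sub_eq_zero, ← map_sub, ← map_sub]
    refine hloc _ _ fun m' hm' => ?_
    rw [map_sub, happ (m.degree + 2) m' (by omega), sub_self]
  rw [h1, hDp]
  classical
  rw [MvPowerSeries.coeff_mul, MvPowerSeries.coeff_mul]
  refine Finset.sum_congr rfl fun q hq => ?_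
  rw [happ]
  have := congrArg Finsupp.degree (Finset.HasAntidiagonal.mem_antidiagonal.1 hq)
  rw [map_add] at this
  omega

theorem dzRing_expSeries {f : WaveRing} (hf : MvPowerSeries.constantCoeff f = 0) :
    dzRing (expSeries f) = dzRing f * expSeries f := by
  refine derivation_expSeries dzHom dzRing_mul (fun g m h => ?_) hf
  change MvPowerSeries.coeff m (dzRing g) = 0
  have h0 : dzLaurent 0 = 0 := map_zero (AddMonoidHom.mk' dzLaurent dzLaurent_add)
  rw [coeff_dzRing, h m (by omega), h0]

theorem dxRing_expSeries {f : WaveRing} (hf : MvPowerSeries.constantCoeff f = 0) :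
    dxRing (expSeries f) = dxRing f * expSeries f := by
  refine derivation_expSeries (AddMonoidHom.mk' dxRing (map_add (pderiv LaurentZ 0))) dxRing_mul (fun g m h => ?_) hf
  change MvPowerSeries.coeff m (pderiv LaurentZ 0 g) = 0
  rw [coeff_pderiv, h _ (by simp), zero_mul]

theorem expSeries_mul_expSeries_neg {f : MvPowerSeries σ LaurentZ}
    (hf : MvPowerSeries.constantCoeff f = 0) : expSeries f * expSeries (-f) = 1 := by
  have hs : PowerSeries.HasSubst f := PowerSeries.HasSubst.of_constantCoeff_zero hf
  have h := congrArg (PowerSeries.substAlgHom (R := LaurentZ) hs)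
    (PowerSeries.exp_mul_exp_neg_eq_one (A := LaurentZ))
  rw [map_mul, map_one, PowerSeries.coe_substAlgHom, PowerSeries.evalNegHom,
    PowerSeries.rescale_eq_subst, PowerSeries.subst_comp_subst_apply
      (PowerSeries.HasSubst.smul_X' _) hs] at h
  have hneg : ((-1 : LaurentZ) • (PowerSeries.X : PowerSeries LaurentZ)).subst f = -f := by
    rw [PowerSeries.subst_smul hs, PowerSeries.subst_X hs, neg_one_smul]
  rw [hneg] at h
  exact h

end KdV

end

noncomputable section

/-! ### The trace formula -/

namespace KdV

open MvPowerSeries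

local notation "ι" => algebraMap WaveRing WaveField

/-- The derivatives of a wave function `f = A τ⁻¹ E`, where `E_z = s ϑ_z E` and `E_x = s z E` for
a sign `s`. -/
theorem fracDeriv_wave {T Tx A Ax Az Axz E θ z s : WaveRing} (hT : T ≠ 0)
    (hTx : dxRing T = Tx) (hTz : dzRing T = 0) (hTxz : dzRing Tx = 0) (hAx : dxRing A = Ax)
    (hAz : dzRing A = Az) (hAxz : dzRing Ax = Axz) (hEx : dxRing E = s * z * E)
    (hEz : dzRing E = s * θ * E) (hs : dzRing s = 0) (hz : dzRing z = 1) :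
    fracDeriv dzRing (ι A / ι T * ι E) = ι ((Az + s * θ * A) * E) / ι T ∧
    fracDeriv dxRing (ι A / ι T * ι E) = ι ((T * (Ax + s * z * A) - A * Tx) * E) / ι T ^ 2 ∧
    fracDeriv dzRing (-fracDeriv dxRing (ι A / ι T * ι E)) =
      -(ι ((T * (Axz + s * A + s * z * Az) - Az * Tx
        + s * θ * (T * (Ax + s * z * A) - A * Tx)) * E) / ι T ^ 2) := by
  have hT' : ι T ≠ 0 := by simpa using hT
  have hf : ι A / ι T * ι E = ι (A * E) / ι T := by
    rw [map_mul]
    ring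
  have hx : fracDeriv dxRing (ι A / ι T * ι E) =
      ι ((T * (Ax + s * z * A) - A * Tx) * E) / ι T ^ 2 := by
    rw [hf, fracDeriv_div dxRing dxRing_mul _ _ hT, dxRing_mul, hAx, hEx, hTx]
    congr 2
    ring
  refine ⟨?_, hx, ?_⟩
  · rw [hf, fracDeriv_div dzRing dzRing_mul _ _ hT, dzRing_mul, hAz, hEz, hTz,
      div_eq_div_iff (pow_ne_zero 2 hT') hT']
    simp only [map_mul, map_add, map_sub, map_zero]
    ring
  · rw [hx, ← map_pow, ← neg_div, ← map_neg,
      fracDeriv_div dzRing dzRing_mul _ _ (pow_ne_zero 2 hT), dzRing_neg, pow_two,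
      dzRing_mul T T, hTz, dzRing_mul _ E, hEz, dzRing_sub, dzRing_mul T, dzRing_mul A, hTxz, hTz,
      hAz, dzRing_add, dzRing_mul _ A, dzRing_mul s z, hs, hz, hAxz, hAz, ← neg_div,
      div_eq_div_iff (by simpa using hT) (by simpa using hT)]
    simp only [map_mul, map_add, map_sub, map_zero, map_neg, map_one]
    ring

theorem grad_wronskian_identity {τ : Fock} (hτ : IsTauFunction τ) :
    4 * PowerSeries.C τ * grad (PowerSeries.C τ) =
      2 * (shift (-1) τ * grad (shift 1 τ) + shift 1 τ * grad (shift (-1) τ)) +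
      PowerSeries.X * (shift 1 τ * grad (shift (-1) (pderiv ℂ 0 τ))
        + shift (-1) (pderiv ℂ 0 τ) * grad (shift 1 τ)
        - shift (-1) τ * grad (shift 1 (pderiv ℂ 0 τ))
        - shift 1 (pderiv ℂ 0 τ) * grad (shift (-1) τ)) := by
  have h := congrArg grad (wronskian_identity hτ)
  have hX : grad PowerSeries.X = 0 := grad_of_timeDeriv_eq_zero fun k => by
    simpa using timeDeriv_X_pow k 1
  have hsub : ∀ f g, grad (f - g) = grad f - grad g := fun f g =>
    map_sub (AddMonoidHom.mk' grad grad_add) f g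
  have h1 : grad 1 = 0 := grad_of_timeDeriv_eq_zero fun k => by
    simpa using timeDeriv_X_pow k 0
  have h2 : grad 2 = 0 := by
    rw [← one_add_one_eq_two, grad_add, h1, add_zero]
  rw [pow_two, grad_mul 2, grad_mul, h2, grad_add, grad_mul 2, h2, grad_mul, grad_mul, hX, hsub,
    grad_mul, grad_mul] at h
  linear_combination h

theorem toField_C_ne_zero {τ : Fock} (hτ : τ ≠ 0) : toField (PowerSeries.C τ) ≠ 0 := fun h =>
  hτ (PowerSeries.C_injective (toField_injective (h.trans (by simp))))

theorem toField_X_mul_zL : toField PowerSeries.X * ι (MvPowerSeries.C zL) = 1 := by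
  change ι (embed PowerSeries.X) * _ = 1
  rw [embed_eq_embedSeries, embedSeries_X, ← map_mul, ← map_mul, zL, HahnSeries.single_mul_single]
  simp

theorem fracDeriv_wave_tau {τ : Fock} (hτ : τ ≠ 0) :
    fracDeriv dzRing (wave τ) = (toField (grad (shift (-1) τ)) +
      ι (dzRing theta) * toField (shift (-1) τ)) * ι (expSeries theta)
        / toField (PowerSeries.C τ) ∧
    fracDeriv dxRing (wave τ) = (toField (PowerSeries.C τ) * (toField (shift (-1) (pderiv ℂ 0 τ)) +
      ι (MvPowerSeries.C zL) * toField (shift (-1) τ))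
      - toField (shift (-1) τ) * toField (PowerSeries.C (pderiv ℂ 0 τ))) * ι (expSeries theta)
        / toField (PowerSeries.C τ) ^ 2 ∧
    fracDeriv dzRing (-fracDeriv dxRing (wave τ)) = -((toField (PowerSeries.C τ) *
      (toField (grad (shift (-1) (pderiv ℂ 0 τ))) + toField (shift (-1) τ)
        + ι (MvPowerSeries.C zL) * toField (grad (shift (-1) τ)))
      - toField (grad (shift (-1) τ)) * toField (PowerSeries.C (pderiv ℂ 0 τ))
      + ι (dzRing theta) * (toField (PowerSeries.C τ) * (toField (shift (-1) (pderiv ℂ 0 τ)) +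
      ι (MvPowerSeries.C zL) * toField (shift (-1) τ))
      - toField (shift (-1) τ) * toField (PowerSeries.C (pderiv ℂ 0 τ)))) * ι (expSeries theta)
        / toField (PowerSeries.C τ) ^ 2) := by
  have hz : ∀ f, dzRing (embed (shift (-1) f)) = embed (grad (shift (-1) f)) := by
    intro f
    rw [dzRing_embed_shift, map_neg, map_neg, map_one, map_one, neg_one_mul, map_neg, neg_neg]
  have h := fracDeriv_wave (T := embed (PowerSeries.C τ)) (A := embed (shift (-1) τ))
    (Tx := embed (PowerSeries.C (pderiv ℂ 0 τ))) (Ax := embed (shift (-1) (pderiv ℂ 0 τ)))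
    (E := expSeries theta) (θ := dzRing theta) (z := MvPowerSeries.C zL) (s := 1)
    (fun h => hτ (PowerSeries.C_injective (embed_injective (h.trans (by simp)))))
    (by rw [dxRing_embed, timeDeriv_C]) (dzRing_embed_C _) (dzRing_embed_C _)
    (by rw [dxRing_embed, timeDeriv_shift]) (hz _) (hz _)
    (by rw [dxRing_expSeries constantCoeff_theta, dxRing_theta, one_mul])
    (by rw [dzRing_expSeries constantCoeff_theta, one_mul]) dzRing_one dzRing_C_zL
  simp only [one_mul, map_mul, map_add, map_sub] at h
  exact h

theorem fracDeriv_dualWave_tau {τ : Fock} (hτ : τ ≠ 0) :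
    fracDeriv dzRing (dualWave τ) = (-toField (grad (shift 1 τ)) -
      ι (dzRing theta) * toField (shift 1 τ)) * ι (expSeries (-theta))
        / toField (PowerSeries.C τ) ∧
    fracDeriv dxRing (dualWave τ) = (toField (PowerSeries.C τ) * (toField (shift 1 (pderiv ℂ 0 τ)) -
      ι (MvPowerSeries.C zL) * toField (shift 1 τ))
      - toField (shift 1 τ) * toField (PowerSeries.C (pderiv ℂ 0 τ))) * ι (expSeries (-theta))
        / toField (PowerSeries.C τ) ^ 2 ∧
    fracDeriv dzRing (-fracDeriv dxRing (dualWave τ)) = -((toField (PowerSeries.C τ) *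
      (-toField (grad (shift 1 (pderiv ℂ 0 τ))) - toField (shift 1 τ)
        + ι (MvPowerSeries.C zL) * toField (grad (shift 1 τ)))
      + toField (grad (shift 1 τ)) * toField (PowerSeries.C (pderiv ℂ 0 τ))
      - ι (dzRing theta) * (toField (PowerSeries.C τ) * (toField (shift 1 (pderiv ℂ 0 τ)) -
      ι (MvPowerSeries.C zL) * toField (shift 1 τ))
      - toField (shift 1 τ) * toField (PowerSeries.C (pderiv ℂ 0 τ)))) * ι (expSeries (-theta))
        / toField (PowerSeries.C τ) ^ 2) := by
  have hz : ∀ f, dzRing (embed (shift 1 f)) = -embed (grad (shift 1 f)) := by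
    intro f
    rw [dzRing_embed_shift, map_one, map_one, one_mul]
  have hc : MvPowerSeries.constantCoeff (-theta) = 0 := by
    rw [map_neg, constantCoeff_theta, neg_zero]
  have hdx : dxRing (-theta) = -MvPowerSeries.C zL := by
    rw [← dxRing_theta]
    exact map_neg (pderiv LaurentZ 0) theta
  have h := fracDeriv_wave (T := embed (PowerSeries.C τ)) (A := embed (shift 1 τ))
    (Tx := embed (PowerSeries.C (pderiv ℂ 0 τ))) (Ax := embed (shift 1 (pderiv ℂ 0 τ)))
    (E := expSeries (-theta)) (θ := dzRing theta) (z := MvPowerSeries.C zL) (s := -1)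
    (fun h => hτ (PowerSeries.C_injective (embed_injective (h.trans (by simp)))))
    (by rw [dxRing_embed, timeDeriv_C]) (dzRing_embed_C _) (dzRing_embed_C _)
    (by rw [dxRing_embed, timeDeriv_shift]) (hz _) (hz _)
    (by rw [dxRing_expSeries hc, hdx, neg_one_mul (MvPowerSeries.C zL)])
    (by rw [dzRing_expSeries hc, dzRing_neg, neg_one_mul (dzRing theta)])
    (by rw [dzRing_neg, dzRing_one, neg_zero]) dzRing_C_zL
  obtain ⟨h1, h2, h3⟩ := h
  refine ⟨h1.trans ?_, h2.trans ?_, h3.trans ?_⟩ <;>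
  · simp only [map_mul, map_add, map_sub, map_neg, map_one, toField, RingHom.comp_apply]
    ring

/-- The Wronskian of the wave functions is `2z`. -/
theorem det_waveMatrix {τ : Fock} (hτ : IsTauFunction τ) :
    (waveMatrix τ).det = 2 * ι (MvPowerSeries.C zL) := by
  have hT := toField_C_ne_zero hτ.ne_zero
  have hz := toField_X_mul_zL
  have hE : ι (expSeries theta) * ι (expSeries (-theta)) = 1 := by
    rw [← map_mul, expSeries_mul_expSeries_neg constantCoeff_theta, map_one]
  have hW := congrArg toField (wronskian_identity hτ)
  obtain ⟨-, h1, -⟩ := fracDeriv_wave_tau hτ.ne_zero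
  obtain ⟨-, h2, -⟩ := fracDeriv_dualWave_tau hτ.ne_zero
  rw [waveMatrix, Matrix.det_fin_two_of, h1, h2, wave, dualWave]
  simp only [map_mul, map_add, map_sub, map_pow, map_ofNat] at hW
  generalize toField (PowerSeries.C τ) = T at *
  generalize toField (PowerSeries.C (pderiv ℂ 0 τ)) = T' at *
  generalize toField (shift (-1) τ) = a at *
  generalize toField (shift 1 τ) = b at *
  generalize toField (shift (-1) (pderiv ℂ 0 τ)) = a' at *
  generalize toField (shift 1 (pderiv ℂ 0 τ)) = b' at *
  generalize ι (expSeries theta) = E at *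
  generalize ι (expSeries (-theta)) = F at *
  generalize ι (MvPowerSeries.C zL) = z at *
  generalize toField PowerSeries.X = y at *
  field_simp
  linear_combination T * (b * a' - a * b' + 2 * z * a * b) * hE - T * z * hW
    - T * (b * a' - a * b') * hz

theorem charZero_waveField : CharZero WaveField :=
  charZero_of_injective_ringHom
    (f := toField.comp ((PowerSeries.C (R := Fock)).comp (MvPowerSeries.C (R := ℂ))))
    (RingHom.injective _)

theorem trace_formula {τ : Fock} (hτ : IsTauFunction τ) :
    seriesToField (F1 τ) = traceFunction τ := by
  have := charZero_waveField
  have hT := toField_C_ne_zero hτ.ne_zero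
  have hz := toField_X_mul_zL
  have hE : ι (expSeries theta) * ι (expSeries (-theta)) = 1 := by
    rw [← map_mul, expSeries_mul_expSeries_neg constantCoeff_theta, map_one]
  have hW := congrArg toField (wronskian_identity hτ)
  have hG := congrArg toField (grad_wronskian_identity hτ)
  have hdet := det_waveMatrix hτ
  obtain ⟨h1, h2, h3⟩ := fracDeriv_wave_tau hτ.ne_zero
  obtain ⟨h4, h5, h6⟩ := fracDeriv_dualWave_tau hτ.ne_zero
  rw [seriesToField_F1 τ hτ.ne_zero, ← grad_C, traceFunction, Matrix.inv_def, hdet,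
    Ring.inverse_eq_inv', waveMatrix, Matrix.adjugate_fin_two_of, sigma3, Matrix.trace_fin_two]
  simp only [Matrix.smul_mul, Matrix.smul_apply, Matrix.mul_apply, Fin.sum_univ_two,
    Matrix.map_apply, Matrix.of_apply, Matrix.cons_val', Matrix.cons_val_zero, Matrix.cons_val_one,
    Matrix.cons_val_fin_one, smul_eq_mul]
  rw [h3, h6, h1, h2, h4, h5, wave, dualWave]
  have hz0 : ι (MvPowerSeries.C zL) ≠ 0 := right_ne_zero_of_mul_eq_one hz
  simp only [map_mul, map_add, map_sub, map_pow, map_ofNat] at hW hG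
  generalize toField (grad (PowerSeries.C τ)) = g at *
  generalize toField (grad (shift (-1) τ)) = ga at *
  generalize toField (grad (shift 1 τ)) = gb at *
  generalize toField (grad (shift (-1) (pderiv ℂ 0 τ))) = ga' at *
  generalize toField (grad (shift 1 (pderiv ℂ 0 τ))) = gb' at *
  generalize toField (PowerSeries.C τ) = T at *
  generalize toField (PowerSeries.C (pderiv ℂ 0 τ)) = T' at *
  generalize toField (shift (-1) τ) = a at *
  generalize toField (shift 1 τ) = b at *
  generalize toField (shift (-1) (pderiv ℂ 0 τ)) = a' at *
  generalize toField (shift 1 (pderiv ℂ 0 τ)) = b' at *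
  generalize ι (expSeries theta) = E at *
  generalize ι (expSeries (-theta)) = F at *
  generalize ι (MvPowerSeries.C zL) = z at *
  generalize ι (dzRing theta) = θ at *
  generalize toField PowerSeries.X = y at *
  have hW' : b * a' - a * b' + 2 * z * a * b = 2 * z * T ^ 2 := by
    linear_combination (-z) * hW - (b * a' - a * b') * hz
  have hG' : 4 * z * T * g = 2 * z * (a * gb + b * ga) +
      (b * ga' + a' * gb - a * gb' - b' * ga) := by
    linear_combination z * hG + (b * ga' + a' * gb - a * gb' - b' * ga) * hz
  field_simp
  linear_combination T * hG' - 2 * T * θ * hW'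
    - (T * (2 * z * (a * gb + b * ga) + (b * ga' + a' * gb - a * gb' - b' * ga))
      + 2 * T * θ * (b * a' - a * b' + 2 * z * a * b)) * hE

end KdV

end

noncomputable section

/-! ### Uniqueness of the tau-function -/

namespace KdV

open MvPowerSeries

/-- The lexicographic monomial order on the infinitely many variables `t₀ < t₁ < ⋯`.  It is a
well-order since there are no infinite strictly increasing chains in `ℕᵒᵈ`. -/
def lexDual : MonomialOrder ℕ where
  syn := (MonomialOrder.lex (σ := ℕᵒᵈ)).syn
  toSyn := (Finsupp.domCongr OrderDual.toDual).trans (MonomialOrder.lex (σ := ℕᵒᵈ)).toSyn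
  toSyn_monotone a b h := (MonomialOrder.lex (σ := ℕᵒᵈ)).toSyn_monotone fun i => h _

theorem exists_eq_C_mul {ρ τ : Fock} (hρ : ρ ≠ 0) (hτ : τ ≠ 0)
    (h : ∀ k, pderiv ℂ k ρ * τ = ρ * pderiv ℂ k τ) :
    ∃ c : ℂ, c ≠ 0 ∧ ρ = MvPowerSeries.C c * τ :=
  exists_eq_C_mul_of_pderiv_mul_eq lexDual hρ hτ h

theorem pderiv_C_mul (c : ℂ) (k : ℕ) (τ : Fock) :
    pderiv ℂ k (MvPowerSeries.C c * τ) = MvPowerSeries.C c * pderiv ℂ k τ := by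
  rw [Derivation.leibniz, pderiv_C, smul_zero, add_zero, smul_eq_mul]

theorem seriesToField_F1_eq_iff {ρ τ : Fock} (hρ : ρ ≠ 0) (hτ : τ ≠ 0) :
    seriesToField (F1 ρ) = seriesToField (F1 τ) ↔
      ∃ c : ℂ, c ≠ 0 ∧ ρ = MvPowerSeries.C c * τ := by
  rw [seriesToField_F1 ρ hρ, seriesToField_F1 τ hτ,
    div_eq_div_iff (toField_C_ne_zero hρ) (toField_C_ne_zero hτ), ← map_mul, ← map_mul]
  constructor
  · intro h
    refine exists_eq_C_mul hρ hτ fun k => ?_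
    have h1 := congrArg (PowerSeries.coeff (2 * k + 2)) (toField_injective h)
    rw [PowerSeries.coeff_mul_C, PowerSeries.coeff_mul_C, PowerSeries.coeff_mk,
      PowerSeries.coeff_mk, if_pos ⟨⟨k + 1, by ring⟩, by omega⟩,
      if_pos ⟨⟨k + 1, by ring⟩, by omega⟩, show (2 * k + 2) / 2 - 1 = k by omega, mul_assoc,
      mul_assoc] at h1
    have h2 : ((Nat.doubleFactorial (2 * k + 2 - 1) : ℕ) : Fock) ≠ 0 := by
      rw [← map_natCast (MvPowerSeries.C (σ := ℕ) (R := ℂ))]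
      intro h0
      exact (Nat.doubleFactorial_pos _).ne' (Nat.cast_injective (R := ℂ)
        (MvPowerSeries.C_injective (h0.trans (by simp))))
    rw [mul_left_cancel₀ h2 h1, mul_comm]
  · rintro ⟨c, -, rfl⟩
    congr 1
    ext1 n
    rw [PowerSeries.coeff_mul_C, PowerSeries.coeff_mul_C, PowerSeries.coeff_mk,
      PowerSeries.coeff_mk]
    split_ifs
    · rw [pderiv_C_mul]
      ring
    · rw [zero_mul, zero_mul]

/-- If the operator `∑_k (2k+1)!! z^(-2k-2) ∂/∂t_k` acts on `τ(t - [z⁻¹])` and `ρ(t - [z⁻¹])`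
with the same logarithmic derivatives, then it does so term by term: the lowest `k` with
`u_k = ∂ₖρ τ - ρ ∂ₖτ ≠ 0` gives the coefficient `(2k+1)!! u_k` of `z^(-2k-2)` in
`∑_k (2k+1)!! z^(-2k-2) u_k(t - [z⁻¹])`. -/
theorem pderiv_mul_eq_of_grad_shift {ε : ℂ} {ρ τ : Fock}
    (h : grad (shift ε ρ) * shift ε τ = shift ε ρ * grad (shift ε τ)) (k : ℕ) :
    pderiv ℂ k ρ * τ = ρ * pderiv ℂ k τ := by
  set u : ℕ → Fock := fun k => pderiv ℂ k ρ * τ - ρ * pderiv ℂ k τ with hu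
  have hN : ∀ N, gradTrunc N (shift ε ρ) * shift ε τ - shift ε ρ * gradTrunc N (shift ε τ) =
      ∑ k ∈ Finset.range N, (Nat.doubleFactorial (2 * k + 1) : FockZ) *
        PowerSeries.X ^ (2 * k + 2) * shift ε (u k) := by
    intro N
    rw [gradTrunc_apply, gradTrunc_apply, Finset.sum_mul, Finset.mul_sum,
      ← Finset.sum_sub_distrib]
    refine Finset.sum_congr rfl fun k _ => ?_
    rw [timeDeriv_shift, timeDeriv_shift]
    simp only [← shiftHom_apply, hu, map_sub, map_mul]
    ring
  have hsum : ∀ N, PowerSeries.coeff N (∑ k ∈ Finset.range N,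
      (Nat.doubleFactorial (2 * k + 1) : FockZ) * PowerSeries.X ^ (2 * k + 2) *
        shift ε (u k)) = 0 := by
    intro N
    rw [← hN, map_sub, PowerSeries.coeff_mul, PowerSeries.coeff_mul]
    have h1 := congrArg (PowerSeries.coeff N) h
    rw [PowerSeries.coeff_mul, PowerSeries.coeff_mul] at h1
    rw [sub_eq_zero]
    convert h1 using 1 <;> refine Finset.sum_congr rfl fun p hp => ?_ <;>
    · have hp' := Finset.HasAntidiagonal.mem_antidiagonal.1 hp
      rw [coeff_grad (N := N) (by omega)]
  have hzero : ∀ k, u k = 0 := by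
    intro k
    induction k using Nat.strong_induction_on with
    | _ k ih =>
      have h1 := hsum (2 * k + 2)
      rw [map_sum, Finset.sum_eq_single k] at h1
      · rw [mul_assoc, ← map_natCast (PowerSeries.C (R := Fock)), PowerSeries.coeff_C_mul,
          PowerSeries.coeff_X_pow_mul', if_pos le_rfl, Nat.sub_self, coeff_zero_shift] at h1
        refine (mul_eq_zero.1 h1).resolve_left ?_
        rw [← map_natCast (MvPowerSeries.C (σ := ℕ) (R := ℂ))]
        intro h0
        exact (Nat.doubleFactorial_pos _).ne' (Nat.cast_injective (R := ℂ)
          (MvPowerSeries.C_injective (h0.trans (by simp))))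
      · intro j _ hj
        rcases lt_or_gt_of_ne hj with hj | hj
        · rw [ih j hj, ← shiftHom_apply, map_zero, mul_zero, map_zero]
        · rw [mul_assoc, ← map_natCast (PowerSeries.C (R := Fock)), PowerSeries.coeff_C_mul,
            PowerSeries.coeff_X_pow_mul', if_neg (by omega), mul_zero]
      · intro hk
        simp only [Finset.mem_range, not_lt] at hk
        omega
  exact sub_eq_zero.1 (hzero k)

theorem wave_eq_iff {ρ τ : Fock} (hρ : ρ ≠ 0) (hτ : τ ≠ 0) :
    wave ρ = wave τ ↔ ∃ c : ℂ, c ≠ 0 ∧ ρ = MvPowerSeries.C c * τ := by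
  have hE : algebraMap WaveRing WaveField (expSeries theta) ≠ 0 := by
    intro h
    have h1 := congrArg (algebraMap WaveRing WaveField)
      (expSeries_mul_expSeries_neg constantCoeff_theta)
    rw [map_mul, h, zero_mul, map_one] at h1
    exact zero_ne_one h1
  constructor
  · intro h
    have h1 := mul_right_cancel₀ hE h
    rw [div_eq_div_iff (toField_C_ne_zero hρ) (toField_C_ne_zero hτ), ← map_mul, ← map_mul] at h1
    have h2 := toField_injective h1
    refine exists_eq_C_mul hρ hτ (pderiv_mul_eq_of_grad_shift (ε := -1) ?_)
    -- differentiate `ρ(t - [z⁻¹]) τ = τ(t - [z⁻¹]) ρ` in `z`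
    have h3 := congrArg (fun f => PowerSeries.X ^ 2 * PowerSeries.derivative Fock f) h2
    simp only [Derivation.leibniz, PowerSeries.derivative_C, smul_eq_mul, mul_zero,
      zero_add] at h3
    have hρ' := X_sq_mul_derivative_shift (-1) ρ
    have hτ' := X_sq_mul_derivative_shift (-1) τ
    rw [map_neg, map_neg, map_one, map_one, neg_one_mul] at hρ' hτ'
    have hC : PowerSeries.C τ ≠ 0 := fun h0 =>
      hτ (PowerSeries.C_injective (h0.trans (map_zero _).symm))
    refine mul_left_cancel₀ hC ?_
    linear_combination (-shift (-1) τ) * h3 + (PowerSeries.C τ * shift (-1) τ) * hρ'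
      - (PowerSeries.C ρ * shift (-1) τ) * hτ' - grad (shift (-1) τ) * h2
  · rintro ⟨c, hc, rfl⟩
    rw [wave, wave]
    congr 1
    rw [div_eq_div_iff (toField_C_ne_zero hρ) (toField_C_ne_zero hτ), ← map_mul, ← map_mul,
      ← shiftHom_apply, ← shiftHom_apply, map_mul, map_mul, shiftHom_C]
    simp only [map_mul]
    ring

end KdV

end

theorem theorem1p2 (τ : KdV.Fock) (hτ : KdV.IsTauFunction τ) :
    IsUnit (KdV.waveMatrix τ).det ∧
    KdV.seriesToField (KdV.F1 τ) = KdV.traceFunction τ ∧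
    (∀ ρ : KdV.Fock, ρ ≠ 0 →
      (KdV.seriesToField (KdV.F1 ρ) = KdV.traceFunction τ ↔
        ∃ c : ℂ, c ≠ 0 ∧ ρ = MvPowerSeries.C c * τ)) ∧
    (∀ ρ : KdV.Fock, KdV.IsTauFunction ρ →
      (KdV.wave ρ = KdV.wave τ ↔ ∃ c : ℂ, c ≠ 0 ∧ ρ = MvPowerSeries.C c * τ)) := by
  refine ⟨?_, KdV.trace_formula hτ, fun ρ hρ => ?_, fun ρ hρ =>
    KdV.wave_eq_iff hρ.ne_zero hτ.ne_zero⟩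
  · have := KdV.charZero_waveField
    rw [KdV.det_waveMatrix hτ]
    exact (mul_ne_zero two_ne_zero (right_ne_zero_of_mul_eq_one KdV.toField_X_mul_zL)).isUnit
  · rw [← KdV.trace_formula hτ]
    exact KdV.seriesToField_F1_eq_iff hρ hτ.ne_zero
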